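/- Let $R$ be a commutative Noetherian ring and $\Gamma$ a Noetherian $R$-algebra (an associative unital $R$-algebra, finitely generated as an $R$-module). Let $M$ be a finitely generated $\Gamma$-bimodule on which $R$ acts centrally, and suppose $M^{\otimes n}=M\otimes_\Gamma\cdots\otimes_\Gamma M=0$ ($n$ factors) for some integer $n\ge 1$. Let $\Gamma\ltimes M=\Gamma\oplus M$ be the trivial extension, with multiplication $(\gamma,m)(\gamma',m')=(\gamma\gamma',\gamma m'+m\gamma')$. For a Noetherian algebra $\Lambda$ let $\mathrm{mod}\text{-}\Lambda$ be the abelian category of finitely generated right $\Lambda$-modules. For an object or class $\mathcal U$, $\mathrm{add}(\mathcal U)$ denotes the class of direct summands of finite direct sums of copies of (objects of) $\mathcal U$. * $\mathrm{IT}(\Lambda)$ is the infimum of the $m\ge 0$ for which there are $t\ge 0$ and $U\in\mathrm{mod}\text{-}\Lambda$ such that for every $X\in\mathrm{mod}\text{-}\Lambda$ there is an exact sequence $0\to U_m\to\cdots\to U_0\to\Omega^t(X)\to 0$ with all $U_i\in\mathrm{add}(U)$, where $\Omega^t(X)$ is a $t$-th syzygy of $X$. * $\dim\Lambda$ is the infimum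 of the $m\ge 0$ for which there is $T\in\mathrm{mod}\text{-}\Lambda$ with $\mathrm{mod}\text{-}\Lambda=[T]_{m+1}$. Here $[T]_1=\mathrm{add}(T)$, and $[T]_{k+1}$ is $\mathrm{add}$ of the class of the $A$ admitting an exact sequence $0\to U\to A\to V\to 0$ with $U\in[T]_1$, $V\in[T]_k$. * $\mathrm{der.dim}\,\mathbf D^b(\mathrm{mod}\text{-}\Lambda)$ is the Rouquier dimension of the bounded derived category: the infimum of the $m\ge 0$ for which $\mathbf D^b(\mathrm{mod}\text{-}\Lambda)=\langle T\rangle_{m+1}$ for some object $T$. Here $\langle T\rangle_1$ is the closure of $T$ under shifts, finite direct sums and direct summands, and $\langle T\rangle_{k+1}$ is the same closure of the class of the $A$ in triangles $U\to A\to V\to U[1]$ with $U\in\langle T\rangle_1$, $V\in\langle T\rangle_k$. All three take values in $\mathbb N\cup\{\infty\}$, an infimum over the empty set being $\infty$. Then: 1. If ${}_\Gamma M$ and $M_\Gamma$ are projective, then $\mathrm{IT}(\Gamma)\le\mathrm{IT}(\Gamma\ltimes M)\le n(\mathrm{IT}(\Gamma)+1)-1$. 2. If $M_\Gamma$ is projective,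 then $\dim\Gamma\le\dim(\Gamma\ltimes M)\le n(\dim\Gamma+1)-1$. 3. If $M$ is left perfect, that is, the left module ${}_\Gamma M$ has finite projective dimension and $\mathrm{Tor}_i^\Gamma(M,M^{\otimes j})=0$ for all $i,j\ge 1$, then $$\mathrm{der.dim}\,\mathbf D^b(\mathrm{mod}\text{-}\Gamma)\le\mathrm{der.dim}\,\mathbf D^b(\mathrm{mod}\text{-}\Gamma\ltimes M)\le n\bigl(\mathrm{der.dim}\,\mathbf D^b(\mathrm{mod}\text{-}\Gamma)+1\bigr)-1.$$ -/

import Mathlib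

open CategoryTheory CategoryTheory.Limits
open scoped TensorProduct

universe w v u

namespace CleftDim

/-! ### Tensor products over a noncommutative ring, tensor powers of bimodules, `Tor` -/

section Tensor

variable (Γ : Type u) [Ring Γ]

/-- The subgroup of `X ⊗_ℤ Y` generated by the elements `xγ ⊗ y - x ⊗ γy`. -/
def balancedRelations (X Y : Type u) [AddCommGroup X] [Module Γᵐᵒᵖ X] [AddCommGroup Y]
    [Module Γ Y] : AddSubgroup (X ⊗[ℤ] Y) :=
  AddSubgroup.closure {z | ∃ (x : X) (γ : Γ) (y : Y),
    z = (MulOpposite.op γ • x) ⊗ₜ[ℤ] y - x ⊗ₜ[ℤ] (γ • y)}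

/-- The tensor product `X ⊗_Γ Y` of a right `Γ`-module `X` and a left `Γ`-module `Y`, over an
arbitrary ring `Γ`. Right `Γ`-modules are `Γᵐᵒᵖ`-modules, with `xγ = op γ • x`. -/
def NCTensor (X Y : Type u) [AddCommGroup X] [Module Γᵐᵒᵖ X] [AddCommGroup Y]
    [Module Γ Y] : Type u :=
  (X ⊗[ℤ] Y) ⧸ balancedRelations Γ X Y

instance (X Y : Type u) [AddCommGroup X] [Module Γᵐᵒᵖ X] [AddCommGroup Y]
    [Module Γ Y] : AddCommGroup (NCTensor Γ X Y) :=
  inferInstanceAs (AddCommGroup ((X ⊗[ℤ] Y) ⧸ balancedRelations Γ X Y))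

variable {Γ}
variable {X Y X' Y' : Type u}
  [AddCommGroup X] [Module Γᵐᵒᵖ X] [AddCommGroup Y] [Module Γ Y]
  [AddCommGroup X'] [Module Γᵐᵒᵖ X'] [AddCommGroup Y'] [Module Γ Y']

/-- The class of `x ⊗ y` in `X ⊗_Γ Y`. -/
def NCTensor.tmul (x : X) (y : Y) : NCTensor Γ X Y :=
  QuotientAddGroup.mk' (balancedRelations Γ X Y) (x ⊗ₜ[ℤ] y)

/-- Functoriality of the tensor product: `f ⊗ g : X ⊗_Γ Y → X' ⊗_Γ Y'`. -/
noncomputable def NCTensor.map (f : X →ₗ[Γᵐᵒᵖ] X') (g : Y →ₗ[Γ] Y') :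
    NCTensor Γ X Y →+ NCTensor Γ X' Y' :=
  QuotientAddGroup.map (balancedRelations Γ X Y) (balancedRelations Γ X' Y')
    (TensorProduct.map f.toAddMonoidHom.toIntLinearMap
      g.toAddMonoidHom.toIntLinearMap).toAddMonoidHom (by
      refine (AddSubgroup.closure_le _).2 ?_
      rintro _ ⟨x, γ, y, rfl⟩
      refine AddSubgroup.subset_closure ⟨f x, γ, g y, ?_⟩
      refine (map_sub _ _ _).trans ?_
      change f (MulOpposite.op γ • x) ⊗ₜ[ℤ] g y - f x ⊗ₜ[ℤ] g (γ • y) = _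
      rw [map_smul, map_smul])

@[simp]
theorem NCTensor.map_tmul (f : X →ₗ[Γᵐᵒᵖ] X') (g : Y →ₗ[Γ] Y') (x : X) (y : Y) :
    NCTensor.map f g (NCTensor.tmul x y) = NCTensor.tmul (f x) (g y) := rfl

theorem NCTensor.tmul_add (x : X) (y y' : Y) :
    (NCTensor.tmul x (y + y') : NCTensor Γ X Y) = NCTensor.tmul x y + NCTensor.tmul x y' :=
  congrArg (QuotientAddGroup.mk' (balancedRelations Γ X Y)) (TensorProduct.tmul_add x y y')

theorem NCTensor.add_tmul (x x' : X) (y : Y) :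
    (NCTensor.tmul (x + x') y : NCTensor Γ X Y) = NCTensor.tmul x y + NCTensor.tmul x' y :=
  congrArg (QuotientAddGroup.mk' (balancedRelations Γ X Y)) (TensorProduct.add_tmul x x' y)

/-- The balancing relation `xγ ⊗ y = x ⊗ γy`. -/
theorem NCTensor.smul_tmul (γ : Γ) (x : X) (y : Y) :
    (NCTensor.tmul (MulOpposite.op γ • x) y : NCTensor Γ X Y) = NCTensor.tmul x (γ • y) := by
  refine (QuotientAddGroup.eq_iff_sub_mem).2 ?_
  exact AddSubgroup.subset_closure ⟨x, γ, y, rfl⟩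

/-- Two additive maps out of `X ⊗_Γ Y` agree if they agree on all `x ⊗ y`. -/
theorem NCTensor.hom_ext {A : Type*} [AddCommGroup A] {f g : NCTensor Γ X Y →+ A}
    (h : ∀ x y, f (NCTensor.tmul x y) = g (NCTensor.tmul x y)) : f = g := by
  ext z
  obtain ⟨z, rfl⟩ := QuotientAddGroup.mk'_surjective (balancedRelations Γ X Y) z
  induction z using TensorProduct.induction_on with
  | zero => exact (map_zero f).trans (map_zero g).symm
  | tmul x y => exact h x y
  | add a b ha hb =>
    exact (map_add f _ _).trans ((congrArg₂ _ ha hb).trans (map_add g _ _).symm)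

/-- Left multiplication by `γ` on a bimodule, as a map of right modules. -/
def leftMul [Module Γ X] [SMulCommClass Γ Γᵐᵒᵖ X] (γ : Γ) : X →ₗ[Γᵐᵒᵖ] X where
  toFun x := γ • x
  map_add' := smul_add γ
  map_smul' δ x := smul_comm γ δ x

/-- Right multiplication by `γ` on a bimodule, as a map of left modules. -/
def rightMul [Module Γᵐᵒᵖ Y] [SMulCommClass Γ Γᵐᵒᵖ Y] (γ : Γᵐᵒᵖ) : Y →ₗ[Γ] Y where
  toFun y := γ • y
  map_add' := smul_add γ
  map_smul' δ y := (smul_comm δ γ y).symm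

/-- The left action `γ(x ⊗ y) = (γx) ⊗ y` when `X` is a bimodule, as a ring homomorphism to the
additive endomorphisms. -/
noncomputable def leftAction [Module Γ X] [SMulCommClass Γ Γᵐᵒᵖ X] :
    Γ →+* AddMonoid.End (NCTensor Γ X Y) where
  toFun γ := NCTensor.map (leftMul γ) LinearMap.id
  map_one' := NCTensor.hom_ext fun x y => congrArg (NCTensor.tmul · y) (one_smul Γ x)
  map_mul' a b := NCTensor.hom_ext fun x y => congrArg (NCTensor.tmul · y) (mul_smul a b x)
  map_zero' := NCTensor.hom_ext fun x y => by
    have h := NCTensor.add_tmul (Γ := Γ) (0 : X) 0 y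
    rw [add_zero, left_eq_add] at h
    exact (congrArg (NCTensor.tmul · y) (zero_smul Γ x)).trans h
  map_add' a b := NCTensor.hom_ext fun x y =>
    (congrArg (NCTensor.tmul · y) (add_smul a b x)).trans (NCTensor.add_tmul _ _ _)

/-- The right action `(x ⊗ y)γ = x ⊗ (yγ)` when `Y` is a bimodule, as a ring homomorphism to the
additive endomorphisms. -/
noncomputable def rightAction [Module Γᵐᵒᵖ Y] [SMulCommClass Γ Γᵐᵒᵖ Y] :
    Γᵐᵒᵖ →+* AddMonoid.End (NCTensor Γ X Y) where
  toFun γ := NCTensor.map LinearMap.id (rightMul γ)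
  map_one' := NCTensor.hom_ext fun x y => congrArg (NCTensor.tmul x) (one_smul Γᵐᵒᵖ y)
  map_mul' a b := NCTensor.hom_ext fun x y => congrArg (NCTensor.tmul x) (mul_smul a b y)
  map_zero' := NCTensor.hom_ext fun x y => by
    have h := NCTensor.tmul_add (Γ := Γ) x (0 : Y) 0
    rw [add_zero, left_eq_add] at h
    exact (congrArg (NCTensor.tmul x) (zero_smul Γᵐᵒᵖ y)).trans h
  map_add' a b := NCTensor.hom_ext fun x y =>
    (congrArg (NCTensor.tmul x) (add_smul a b y)).trans (NCTensor.tmul_add _ _ _)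

/-- The left `Γ`-module structure on `X ⊗_Γ Y` for a bimodule `X`. -/
noncomputable abbrev NCTensor.leftModule [Module Γ X] [SMulCommClass Γ Γᵐᵒᵖ X] :
    Module Γ (NCTensor Γ X Y) where
  smul γ z := leftAction γ z
  one_smul z := DFunLike.congr_fun (map_one leftAction) z
  mul_smul a b z := DFunLike.congr_fun (map_mul leftAction a b) z
  smul_zero a := map_zero (leftAction a)
  smul_add a := map_add (leftAction a)
  add_smul a b z := DFunLike.congr_fun (map_add leftAction a b) z
  zero_smul z := DFunLike.congr_fun (map_zero leftAction) z

/-- The right `Γ`-module structure on `X ⊗_Γ Y` for a bimodule `Y`. -/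
noncomputable abbrev NCTensor.rightModule [Module Γᵐᵒᵖ Y] [SMulCommClass Γ Γᵐᵒᵖ Y] :
    Module Γᵐᵒᵖ (NCTensor Γ X Y) where
  smul γ z := rightAction γ z
  one_smul z := DFunLike.congr_fun (map_one rightAction) z
  mul_smul a b z := DFunLike.congr_fun (map_mul rightAction a b) z
  smul_zero a := map_zero (rightAction a)
  smul_add a := map_add (rightAction a)
  add_smul a b z := DFunLike.congr_fun (map_add rightAction a b) z
  zero_smul z := DFunLike.congr_fun (map_zero rightAction) z

variable (Γ) in
/-- A bundled `Γ`-bimodule. -/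
structure BimoduleObj where
  carrier : Type u
  [addCommGroup : AddCommGroup carrier]
  [leftModule : Module Γ carrier]
  [rightModule : Module Γᵐᵒᵖ carrier]
  [smulComm : SMulCommClass Γ Γᵐᵒᵖ carrier]

attribute [instance] BimoduleObj.addCommGroup BimoduleObj.leftModule BimoduleObj.rightModule
  BimoduleObj.smulComm

/-- The tensor product of bimodules over `Γ`, with its outer bimodule structure. -/
noncomputable def BimoduleObj.tensor (X Y : BimoduleObj Γ) : BimoduleObj Γ :=
  { carrier := NCTensor Γ X.carrier Y.carrier
    addCommGroup := inferInstance
    leftModule := NCTensor.leftModule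
    rightModule := NCTensor.rightModule
    smulComm :=
      letI := NCTensor.leftModule (Γ := Γ) (X := X.carrier) (Y := Y.carrier)
      letI := NCTensor.rightModule (Γ := Γ) (X := X.carrier) (Y := Y.carrier)
      ⟨fun a b z => by
        have h : (leftAction a * rightAction b : AddMonoid.End (NCTensor Γ X.carrier Y.carrier)) =
            rightAction b * leftAction a := NCTensor.hom_ext fun x y => rfl
        exact DFunLike.congr_fun h z⟩ }

/-- The tensor powers of a bimodule over `Γ`: the zeroth is `Γ`, the first is `X`, and
`X^{⊗(n+2)} = X^{⊗(n+1)} ⊗_Γ X`. -/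
noncomputable def BimoduleObj.pow (X : BimoduleObj Γ) : ℕ → BimoduleObj Γ
  | 0 => ⟨Γ⟩
  | 1 => X
  | n + 2 => (BimoduleObj.pow X (n + 1)).tensor X

variable (Γ) in
/-- The `n`-th tensor power `M^{⊗n}` over `Γ` of a `Γ`-bimodule `M`. -/
noncomputable abbrev tensorPower (M : Type u) [AddCommGroup M] [Module Γ M] [Module Γᵐᵒᵖ M]
    [SMulCommClass Γ Γᵐᵒᵖ M] (n : ℕ) : BimoduleObj Γ :=
  (BimoduleObj.mk M).pow n

variable (Γ) in
/-- The functor `- ⊗_Γ Y` from right `Γ`-modules to abelian groups. -/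
noncomputable def tensorFunctor (Y : Type u) [AddCommGroup Y] [Module Γ Y] :
    ModuleCat.{u} Γᵐᵒᵖ ⥤ AddCommGrpCat.{u} where
  obj X := AddCommGrpCat.of (NCTensor Γ X Y)
  map f := AddCommGrpCat.ofHom (NCTensor.map f.hom LinearMap.id)
  map_id _ := AddCommGrpCat.hom_ext (NCTensor.hom_ext fun _ _ => rfl)
  map_comp _ _ := AddCommGrpCat.hom_ext (NCTensor.hom_ext fun _ _ => rfl)

instance (Y : Type u) [AddCommGroup Y] [Module Γ Y] : (tensorFunctor Γ Y).Additive where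
  map_add {_ _ f g} := AddCommGrpCat.hom_ext (NCTensor.hom_ext fun x y =>
    NCTensor.add_tmul (f.hom x) (g.hom x) y)

variable (Γ) in
/-- `Tor_i^Γ(X, Y)` for a right `Γ`-module `X` and a left `Γ`-module `Y`: the `i`-th left derived
functor of `- ⊗_Γ Y`, evaluated at `X`. -/
noncomputable def ncTor (i : ℕ) (X Y : Type u) [AddCommGroup X] [Module Γᵐᵒᵖ X]
    [AddCommGroup Y] [Module Γ Y] : AddCommGrpCat.{u} :=
  ((tensorFunctor Γ Y).leftDerived i).obj (ModuleCat.of Γᵐᵒᵖ X)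

variable (Γ) in
/-- A `Γ`-bimodule `M` is left perfect if it has finite projective dimension as a left module and
`Tor_i^Γ(M, M^{⊗j}) = 0` for all `i, j ≥ 1`. -/
structure IsLeftPerfect (M : Type u) [AddCommGroup M] [Module Γ M] [Module Γᵐᵒᵖ M]
    [SMulCommClass Γ Γᵐᵒᵖ M] : Prop where
  projectiveDimension_lt_top : projectiveDimension (ModuleCat.of Γ M) < ⊤
  isZero_tor : ∀ i j : ℕ, 1 ≤ i → 1 ≤ j → IsZero (ncTor Γ i M (tensorPower Γ M j).carrier)

end Tensor

/-! ### Igusa-Todorov distance and extension dimension of an abelian category -/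

section Abelian

variable {C : Type u} [Category.{v} C] [Abelian C]

attribute [local instance] Abelian.hasFiniteBiproducts

/-- `add 𝒰`: the direct summands of finite direct sums of objects of `𝒰`. -/
def addClosure (𝒰 : ObjectProperty C) : ObjectProperty C := fun X =>
  ∃ (n : ℕ) (f : Fin n → C), (∀ i, 𝒰 (f i)) ∧ Nonempty (Retract X (⨁ f))

/-- `add U` for a single object `U`. -/
abbrev addObj (U : C) : ObjectProperty C := addClosure (ObjectProperty.singleton U)

/-- `K` is an `n`-th syzygy of `X`. (Syzygies depend on the choice of the projective covering
objects, only up to projective summands.) -/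
def IsSyzygy : ℕ → C → C → Prop
  | 0, X, K => Nonempty (K ≅ X)
  | n + 1, X, K => ∃ S : ShortComplex C, S.ShortExact ∧ Projective S.X₂ ∧
      Nonempty (S.X₃ ≅ X) ∧ IsSyzygy n S.X₁ K

/-- There is an exact sequence `0 → U_m → ⋯ → U_1 → U_0 → K → 0` with all `U_i` in `add U`.
It is built by splicing short exact sequences. -/
def HasAddResolution (U : C) : ℕ → C → Prop
  | 0, K => addObj U K
  | m + 1, K => ∃ S : ShortComplex C, S.ShortExact ∧ addObj U S.X₂ ∧
      Nonempty (S.X₃ ≅ K) ∧ HasAddResolution U m S.X₁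

variable (C) in
/-- `C` is an `(m, n)`-Igusa-Todorov category. -/
def IsIgusaTodorovCategory (m n : ℕ) : Prop :=
  ∃ U : C, ∀ A : C, ∃ K : C, IsSyzygy n A K ∧ HasAddResolution U m K

variable (C) in
/-- The Igusa-Todorov distance of `C`. It is `⊤` if `C` is `(m, n)`-Igusa-Todorov for no `m, n`. -/
noncomputable def igusaTodorovDistance : ℕ∞ :=
  ⨅ (m : ℕ) (_ : ∃ n, IsIgusaTodorovCategory C m n), (m : ℕ∞)

/-- `𝒰 • 𝒱`: the direct summands of finite direct sums of objects `A` that sit in a short exact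
sequence `0 → U → A → V → 0` with `U` in `𝒰` and `V` in `𝒱`. -/
def extProduct (𝒰 𝒱 : ObjectProperty C) : ObjectProperty C :=
  addClosure fun A => ∃ S : ShortComplex C, S.ShortExact ∧ 𝒰 S.X₁ ∧ 𝒱 S.X₃ ∧ Nonempty (S.X₂ ≅ A)

/-- `[T]_n`: `[T]_0 = 0`, `[T]_1 = add T` and `[T]_n = [T]_1 • [T]_{n-1}` for `n ≥ 2`. -/
def extPower (T : C) : ℕ → ObjectProperty C
  | 0 => fun X => IsZero X
  | 1 => addObj T
  | n + 2 => extProduct (addObj T) (extPower T (n + 1))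

variable (C) in
/-- The extension dimension of `C`. -/
noncomputable def extensionDimension : ℕ∞ :=
  ⨅ (n : ℕ) (_ : ∃ T : C, ∀ X : C, extPower T (n + 1) X), (n : ℕ∞)

end Abelian

/-! ### Rouquier dimension -/

/-- The Rouquier dimension of a triangulated category. For the property of being equal to `T`,
`triangEnvelopeIter n` is `⟨T⟩_{n+1}`: the objects reached from `T` by shifts, finite direct sums,
direct summands and at most `n` extensions. -/
noncomputable def rouquierDimension (𝒯 : Type u) [Category.{v} 𝒯] [HasZeroObject 𝒯]
    [HasShift 𝒯 ℤ] [Preadditive 𝒯] [∀ n : ℤ, (shiftFunctor 𝒯 n).Additive]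
    [Pretriangulated 𝒯] : ℕ∞ :=
  ⨅ (n : ℕ) (_ : ∃ T : 𝒯, (ObjectProperty.singleton T).triangEnvelopeIter n = ⊤), (n : ℕ∞)

/-- The Rouquier dimension of the bounded derived category of an abelian category. -/
noncomputable def derivedDimension (C : Type u) [Category.{v} C] [Abelian C] : ℕ∞ :=
  letI := HasDerivedCategory.standard C
  rouquierDimension (DerivedCategory.Bounded C)

/-! ### Finitely generated right modules over a ring -/

/-- An algebra that is module-finite over a commutative Noetherian ring is right Noetherian, so
its finitely generated right modules form an abelian category. -/
theorem isNoetherianRing_op (R : Type w) (Λ : Type u) [CommRing R] [IsNoetherianRing R] [Ring Λ]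
    [Algebra R Λ] [Module.Finite R Λ] : IsNoetherianRing Λᵐᵒᵖ :=
  haveI : Module.Finite R Λᵐᵒᵖ := Module.Finite.equiv (MulOpposite.opLinearEquiv R (M := Λ))
  haveI : IsNoetherian R Λᵐᵒᵖ := isNoetherian_of_isNoetherianRing_of_finite R Λᵐᵒᵖ
  isNoetherian_of_tower R inferInstance

/-- The trivial extension of a module-finite algebra by a finitely generated module is
module-finite. -/
theorem finite_trivSqZeroExt (R : Type w) (Γ M : Type u) [CommRing R] [Ring Γ] [Algebra R Γ]
    [Module.Finite R Γ] [AddCommGroup M] [Module R M] [Module.Finite R M] :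
    Module.Finite R (TrivSqZeroExt Γ M) :=
  inferInstanceAs (Module.Finite R (Γ × M))

section Ring

variable (Λ : Type u) [Ring Λ] [IsNoetherianRing Λᵐᵒᵖ]

/-- The category `mod-Λ` of finitely generated right `Λ`-modules. -/
abbrev ModCat : Type (u + 1) := FGModuleCat.{u} Λᵐᵒᵖ

/-- `IT(Λ)`, the Igusa-Todorov distance of `mod-Λ`. -/
noncomputable abbrev IT : ℕ∞ := igusaTodorovDistance (ModCat Λ)

/-- `dim Λ`, the extension dimension of `mod-Λ`. -/
noncomputable abbrev extDim : ℕ∞ := extensionDimension (ModCat Λ)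

/-- The Rouquier dimension of `D^b(mod-Λ)`. -/
noncomputable abbrev derDim : ℕ∞ := derivedDimension (ModCat Λ)

end Ring

end CleftDim

namespace CleftDim

/-! ### Infima of sets of natural numbers -/

/-! Write `Λ` for the trivial extension `Γ ⋉ M`. The ring maps `Γ → Λ → Γ` compose to the identity,
so restriction along `Λ → Γ` followed by restriction along `Γ → Λ` is the identity of `mod-Γ`. Both
restrictions are exact, and a generating object or resolution over `Λ` restricts to one over `Γ`.
This gives the three lower bounds (the lemmas `*_le_of_section`). For the Igusa-Todorov distance,
syzygies must restrict to syzygies as well; they do because `Λ ≅ Γ ⊕ M` is projective as a right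
`Γ`-module.

For the extension dimension and the derived dimension, the upper bound comes from the square-zero
ideal `M` of `Λ`. Let `X'` be the elements of a `Λ`-module `X` killed by `M`. Since `XM ⊆ X'`, both
`X'` and `X / X'` are `Γ`-modules, so `X` is functorially an extension of two modules restricted
from `Γ` (`killed_shortExact`). Two blocks of `d + 1` layers give `2(d + 1) - 1`, also termwise on
bounded complexes. For `n ≥ 2` this is at most `n(d + 1) - 1`; for `n = 1` the bimodule `M` is zero
and `Λ = Γ` (`bound_of_two_or_subsingleton`).

Restriction along `Λ → Γ` need not preserve projectives, so the Igusa-Todorov distance uses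
induction `F Y = Y ⊗_Γ Λ = Y ⊕ (Y ⊗_Γ M)` instead. It is exact because `M` is left projective, and
it preserves projectives, being left adjoint to an exact functor. The kernel `G X` of the counit `F
X → X` is, over `Γ`, a quotient of `X ⊗_Γ M`; hence `G^n X` is generated by images of `M^{⊗n} = 0`
and vanishes (`isZero_iterate_kerCounit`). From `0 → G X → F X → X → 0`, a syzygy of `X` is an
extension of `G X` by a syzygy of `F X`.

To count, resolutions are traded for filtrations. After enough syzygies, a resolution of length `m`
by `add U` becomes a filtration with `m + 1` layers in some `add V`; conversely, a filtration with
`m + 1` layers yields a resolution of length `m` by a larger object. Each of the `n` steps from `X`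
down to `G^n X = 0` contributes `m + 1` layers, so `n(m + 1)` layers suffice and the final length is
`n(m + 1) - 1` (`igusaTodorovDistance_le_of_nilpotent`). -/

theorem le_mul_iInf_add_one_sub_one {P : ℕ → Prop} {x : ℕ∞} {k : ℕ} (hk : 1 ≤ k)
    (h : ∀ m, P m → x ≤ ((k * (m + 1) - 1 : ℕ) : ℕ∞)) :
    x ≤ k * ((⨅ (m : ℕ) (_ : P m), (m : ℕ∞)) + 1) - 1 := by
  classical
  by_cases hP : ∃ m, P m
  · have : (⨅ (m : ℕ) (_ : P m), (m : ℕ∞)) = (Nat.find hP : ℕ) :=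
      le_antisymm (iInf₂_le _ (Nat.find_spec hP))
        (le_iInf₂ fun n hn => by exact_mod_cast Nat.find_min' hP hn)
    rw [this]
    exact_mod_cast h _ (Nat.find_spec hP)
  · have : (⨅ (m : ℕ) (_ : P m), (m : ℕ∞)) = ⊤ := by
      push Not at hP
      simp [hP]
    -- With no admissible `m` the infimum is `⊤`; here `k ≠ 0` matters, since `0 * ⊤ = 0`.
    rw [this, top_add, ENat.mul_top (by exact_mod_cast (by lia : k ≠ 0))]
    exact le_top

/-! ### Rouquier dimension and exact functors -/

section Rouquier

open ObjectProperty Pretriangulated DerivedCategory.TStructure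

/-- A triangulated functor respects shifts, finite products, retracts and distinguished triangles,
hence every stage of the envelope. The stage without extensions is isolated as `base`, because it is
also the left factor in each later stage. -/
theorem triangEnvelopeIter_le_inverseImage {𝒯 𝒯' : Type*} [Category* 𝒯] [Category* 𝒯']
    [HasZeroObject 𝒯] [HasShift 𝒯 ℤ] [Preadditive 𝒯] [∀ n : ℤ, (shiftFunctor 𝒯 n).Additive]
    [Pretriangulated 𝒯] [HasZeroObject 𝒯'] [HasShift 𝒯' ℤ] [Preadditive 𝒯']
    [∀ n : ℤ, (shiftFunctor 𝒯' n).Additive] [Pretriangulated 𝒯']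
    (G : 𝒯 ⥤ 𝒯') [G.CommShift ℤ] [G.IsTriangulated] {P : ObjectProperty 𝒯}
    {Q : ObjectProperty 𝒯'} (h : P ≤ Q.inverseImage G) (n : ℕ) :
    P.triangEnvelopeIter n ≤ (Q.triangEnvelopeIter n).inverseImage G := by
  have base : (P.shiftClosure ℤ).binaryProductsClosure.retractClosure ≤
      ((Q.shiftClosure ℤ).binaryProductsClosure.retractClosure).inverseImage G := by
    rintro X ⟨Y, hY, ⟨r⟩⟩
    refine ⟨G.obj Y, ?_, ⟨r.map G⟩⟩
    clear r
    induction hY with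
    | of_mem X hX =>
      obtain ⟨Z, a, e, hZ⟩ := hX
      exact .of_mem _ ⟨G.obj Z, a, G.mapIso e ≪≫ (G.commShiftIso a).app Z, h _ hZ⟩
    | of_isoClosure e _ ih => exact .of_isoClosure (G.mapIso e) ih
    | of_limitPresentation pres _ ih =>
      exact .of_limitPresentation (a := ()) (pres.map G) ih
  induction n with
  | zero => simpa only [triangEnvelopeIter_zero] using base
  | succ n ih =>
    simp only [triangEnvelopeIter_succ]
    rintro X ⟨Y, ⟨A, B, f, g, k, hT, hA, hB⟩, ⟨r⟩⟩
    exact ⟨G.obj Y, ⟨_, _, _, _, _, G.map_distinguished _ hT, base _ hA, ih _ hB⟩, ⟨r.map G⟩⟩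

variable {C D : Type u} [Category.{v} C] [Category.{v} D] [Abelian C] [Abelian D]
  [HasDerivedCategory.{w} C] [HasDerivedCategory.{w} D]

theorem bounded_mapDerivedCategory (F : C ⥤ D) [F.Additive] [PreservesFiniteLimits F]
    [PreservesFiniteColimits F] (X : DerivedCategory C)
    (hX : (t : Triangulated.TStructure (DerivedCategory C)).bounded X) :
    (t : Triangulated.TStructure (DerivedCategory D)).bounded (F.mapDerivedCategory.obj X) := by
  obtain ⟨⟨a, ⟨K, e, hK⟩⟩, ⟨b, ⟨L, e', hL⟩⟩⟩ := hX
  exact ⟨⟨a, ⟨(F.mapHomologicalComplex _).obj K,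
    F.mapDerivedCategory.mapIso e ≪≫ F.mapDerivedCategoryFactors.app K, inferInstance⟩⟩,
    ⟨b, ⟨(F.mapHomologicalComplex _).obj L,
    F.mapDerivedCategory.mapIso e' ≪≫ F.mapDerivedCategoryFactors.app L, inferInstance⟩⟩⟩

/-- The functor induced by an exact functor on bounded derived categories. -/
noncomputable abbrev mapBounded (F : C ⥤ D) [F.Additive] [PreservesFiniteLimits F]
    [PreservesFiniteColimits F] : DerivedCategory.Bounded C ⥤ DerivedCategory.Bounded D :=
  ObjectProperty.lift _ (DerivedCategory.Bounded.ι ⋙ F.mapDerivedCategory)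
    fun X => bounded_mapDerivedCategory F X.1 X.2

/-- A bounded complex, as an object of the bounded derived category. -/
noncomputable def boundedQ (K : CochainComplex C ℤ) (a b : ℤ) [K.IsStrictlyGE a]
    [K.IsStrictlyLE b] : DerivedCategory.Bounded C :=
  ⟨DerivedCategory.Q.obj K, ⟨a, ⟨K, Iso.refl _, inferInstance⟩⟩,
    ⟨b, ⟨K, Iso.refl _, inferInstance⟩⟩⟩

/-- A strictly bounded representative allows functors that are only additive to be applied termwise,
although they do not descend to derived categories as they stand. -/
theorem exists_iso_boundedQ (X : DerivedCategory.Bounded C) :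
    ∃ (K : CochainComplex C ℤ) (a b : ℤ) (_ : K.IsStrictlyGE a) (_ : K.IsStrictlyLE b),
      Nonempty (X ≅ boundedQ K a b) := by
  obtain ⟨X, ⟨a, ha⟩, ⟨b, hb⟩⟩ := X
  have : X.IsGE a := ⟨ha.ge⟩
  have : X.IsLE b := ⟨hb.le⟩
  obtain ⟨K, h₁, h₂, ⟨e⟩⟩ := X.exists_iso_Q_obj_of_isGE_of_isLE a b
  exact ⟨K, a, b, h₁, h₂, ⟨(ObjectProperty.fullyFaithfulι _).preimageIso e⟩⟩

/-- Full faithfulness lifts the three maps; only the connecting map needs a correction, by the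
isomorphism comparing the shift of the subcategory with the ambient one. -/
theorem extensionProduct_of_distinguished {𝒯 : Type*} [Category* 𝒯]
    [HasZeroObject 𝒯] [HasShift 𝒯 ℤ] [Preadditive 𝒯] [∀ n : ℤ, (shiftFunctor 𝒯 n).Additive]
    [Pretriangulated 𝒯] {P : ObjectProperty 𝒯} [P.IsTriangulated]
    {U V : ObjectProperty P.FullSubcategory} {A X B : P.FullSubcategory}
    (f : A.obj ⟶ X.obj) (g : X.obj ⟶ B.obj) (k : B.obj ⟶ A.obj⟦(1 : ℤ)⟧)
    (hT : Triangle.mk f g k ∈ distTriang 𝒯) (hA : U A) (hB : V B) :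
    extensionProduct U V X := by
  refine ⟨A, B, P.fullyFaithfulι.preimage f, P.fullyFaithfulι.preimage g,
    P.fullyFaithfulι.preimage (k ≫ (P.ι.commShiftIso (1 : ℤ)).inv.app A),
    isomorphic_distinguished _ hT _ ?_, hA, hB⟩
  refine Triangle.isoMk _ _ (Iso.refl _) (Iso.refl _) (Iso.refl _)
    ((Category.comp_id f).trans (Category.id_comp f).symm)
    ((Category.comp_id g).trans (Category.id_comp g).symm) ?_
  change ((k ≫ (P.ι.commShiftIso (1 : ℤ)).inv.app A) ≫ (P.ι.commShiftIso (1 : ℤ)).hom.app A) ≫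
    (𝟙 A.obj)⟦(1 : ℤ)⟧' = 𝟙 B.obj ≫ k
  refine (congrArg (_ ≫ ·) ((shiftFunctor 𝒯 (1 : ℤ)).map_id A.obj)).trans ?_
  refine (Category.comp_id _).trans ?_
  refine (Category.assoc _ _ _).trans ?_
  refine (congrArg (k ≫ ·) (Iso.inv_hom_id_app (P.ι.commShiftIso (1 : ℤ)) A)).trans ?_
  exact (Category.comp_id k).trans (Category.id_comp k).symm

end Rouquier

/-! ### Bounds on derived dimensions from sections and from functorial extensions. -/

section DerivedDimension

open ObjectProperty Pretriangulated DerivedCategory.TStructure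

variable {C D : Type u} [Category.{v} C] [Category.{v} D] [Abelian C] [Abelian D]

/-- The section `G` need not be exact: applied termwise to a bounded complex `K` it gives a bounded
complex that `F` sends back to `K`, and this makes `F` essentially surjective on bounded derived
categories. -/
theorem derivedDimension_le_of_section (F : C ⥤ D) [F.Additive] [PreservesFiniteLimits F]
    [PreservesFiniteColimits F] (G : D ⥤ C) [G.Additive] (e : G ⋙ F ≅ 𝟭 D) :
    derivedDimension D ≤ derivedDimension C := by
  let _ := HasDerivedCategory.standard C
  let _ := HasDerivedCategory.standard D
  refine le_iInf₂ fun n ⟨T, hT⟩ => iInf₂_le n ⟨(mapBounded F).obj T, ?_⟩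
  refine top_unique fun X _ => ?_
  obtain ⟨K, a, b, _, _, ⟨e'⟩⟩ := exists_iso_boundedQ X
  let L : CochainComplex C ℤ := (G.mapHomologicalComplex (ComplexShape.up ℤ)).obj K
  have : L.IsStrictlyGE a :=
    inferInstanceAs (CochainComplex.IsStrictlyGE ((G.mapHomologicalComplex _).obj K) a)
  have : L.IsStrictlyLE b :=
    inferInstanceAs (CochainComplex.IsStrictlyLE ((G.mapHomologicalComplex _).obj K) b)
  have h := triangEnvelopeIter_le_inverseImage (mapBounded F)
    (P := ObjectProperty.singleton T) (Q := ObjectProperty.singleton ((mapBounded F).obj T))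
    (by rw [singleton_le_iff]; exact (singleton_iff _ _).2 rfl) n (boundedQ L a b)
    (by rw [hT]; trivial)
  refine ObjectProperty.prop_of_iso _ ?_ h
  refine ?_ ≪≫ e'.symm
  refine (ObjectProperty.fullyFaithfulι _).preimageIso ?_
  let ε : (F.mapHomologicalComplex _).obj L ≅ K :=
    HomologicalComplex.Hom.isoOfComponents (fun i => e.app (K.X i))
      (fun i j _ => (e.hom.naturality (K.d i j)).symm)
  exact F.mapDerivedCategoryFactors.app L ≪≫ DerivedCategory.Q.mapIso ε

/-- Naturality of `f` and `g` turns the objectwise sequences into a degreewise short exact sequence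
of complexes, hence a triangle whose outer terms come from `D`. The functors `A` and `B` need only
be additive. -/
theorem derivedDimension_le_of_extension (I : D ⥤ C) [I.Additive] [PreservesFiniteLimits I]
    [PreservesFiniteColimits I] (A B : C ⥤ D) [A.Additive] [B.Additive] (f : A ⋙ I ⟶ 𝟭 C)
    (g : 𝟭 C ⟶ B ⋙ I) (w : ∀ X, f.app X ≫ g.app X = 0)
    (h : ∀ X, (ShortComplex.mk (f.app X) (g.app X) (w X)).ShortExact) :
    derivedDimension C ≤ (2 : ℕ) * (derivedDimension D + 1) - 1 := by
  let _ := HasDerivedCategory.standard C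
  let _ := HasDerivedCategory.standard D
  refine le_mul_iInf_add_one_sub_one (by norm_num) ?_
  rintro m ⟨T, hT⟩
  refine iInf₂_le (2 * (m + 1) - 1) ⟨(mapBounded I).obj T, ?_⟩
  refine top_unique fun X _ => ?_
  obtain ⟨K, a, b, _, _, ⟨e'⟩⟩ := exists_iso_boundedQ X
  have mem : ∀ (E : C ⥤ D) [E.Additive], (ObjectProperty.singleton
      ((mapBounded I).obj T)).triangEnvelopeIter m
        (boundedQ (((E ⋙ I).mapHomologicalComplex _).obj K) a b) := by
    intro E _
    have h := triangEnvelopeIter_le_inverseImage (mapBounded I)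
      (P := ObjectProperty.singleton T)
      (Q := ObjectProperty.singleton ((mapBounded I).obj T))
      (by rw [singleton_le_iff]; exact (singleton_iff _ _).2 rfl) m
      (boundedQ ((E.mapHomologicalComplex _).obj K) a b) (by rw [hT]; trivial)
    refine ObjectProperty.prop_of_iso _ ?_ h
    exact (ObjectProperty.fullyFaithfulι _).preimageIso
      (I.mapDerivedCategoryFactors.app ((E.mapHomologicalComplex _).obj K))
  refine ObjectProperty.prop_of_iso _ e'.symm ?_
  -- Stage `m` of the envelope is `⟨T⟩_{m+1}`, so extending stage `m` by stage `m` costs one further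
  -- extension and gives stage `2m + 1`.
  rw [show 2 * (m + 1) - 1 = (m + 1) + m by lia, triangEnvelopeIter_add _ rfl]
  refine le_retractClosure _ _ ?_
  let S : ShortComplex (CochainComplex C ℤ) := ShortComplex.mk
    (X₁ := ((A ⋙ I).mapHomologicalComplex _).obj K) (X₂ := K)
    (X₃ := ((B ⋙ I).mapHomologicalComplex _).obj K)
    { f := fun i => f.app (K.X i), comm' := fun i j _ => (f.naturality (K.d i j)).symm }
    { f := fun i => g.app (K.X i), comm' := fun i j _ => (g.naturality (K.d i j)).symm }
    (by ext i; exact w (K.X i))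
  have hS : S.ShortExact :=
    HomologicalComplex.shortExact_of_degreewise_shortExact _ fun i => h (K.X i)
  exact extensionProduct_of_distinguished
    (A := boundedQ (((A ⋙ I).mapHomologicalComplex _).obj K) a b) (X := boundedQ K a b)
    (B := boundedQ (((B ⋙ I).mapHomologicalComplex _).obj K) a b)
    (DerivedCategory.Q.map S.f) (DerivedCategory.Q.map S.g) (DerivedCategory.triangleOfSESδ hS)
    (DerivedCategory.triangleOfSES_distinguished hS) (mem A) (mem B)

end DerivedDimension

/-! ### Additive closures -/

section Abelian

variable {C : Type u} [Category.{v} C] [Abelian C]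

attribute [local instance] Abelian.hasFiniteBiproducts

/-- Describing a summand by a decomposition of the identity removes the chosen biproduct, allows any
finite index type, and is visibly preserved by additive functors. -/
theorem addClosure_iff {𝒰 : ObjectProperty C} {X : C} : addClosure 𝒰 X ↔
    ∃ (ι : Type) (_ : Fintype ι) (f : ι → C) (a : ∀ i, X ⟶ f i) (b : ∀ i, f i ⟶ X),
      (∀ i, 𝒰 (f i)) ∧ ∑ i, a i ≫ b i = 𝟙 X := by
  constructor
  · rintro ⟨n, f, hf, ⟨r⟩⟩
    refine ⟨Fin n, inferInstance, f, fun i => r.i ≫ biproduct.π f i,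
      fun i => biproduct.ι f i ≫ r.r, hf, ?_⟩
    have := congrArg (fun k => r.i ≫ k ≫ r.r) (biproduct.total (f := f))
    simpa only [Preadditive.comp_sum, Preadditive.sum_comp, Category.assoc, Category.id_comp,
      r.retract] using this
  · rintro ⟨ι, _, f, a, b, hf, h⟩
    let e := (Fintype.equivFin ι).symm
    refine ⟨_, f ∘ e, fun i => hf _, ⟨⟨biproduct.lift fun i => a (e i),
      biproduct.desc fun i => b (e i), ?_⟩⟩⟩
    rw [biproduct.lift_desc, ← h]
    exact e.sum_comp fun i => a i ≫ b i

theorem addClosure_of_retract {𝒰 : ObjectProperty C} {X Y : C} (r : Retract X Y)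
    (h : addClosure 𝒰 Y) : addClosure 𝒰 X := by
  obtain ⟨n, f, hf, ⟨s⟩⟩ := h
  exact ⟨n, f, hf, ⟨r.trans s⟩⟩

theorem addClosure_of_isZero {𝒰 : ObjectProperty C} {X : C} (h : IsZero X) : addClosure 𝒰 X :=
  ⟨0, fun i => i.elim0, fun i => i.elim0, ⟨h.retract _⟩⟩

theorem le_addClosure (𝒰 : ObjectProperty C) : 𝒰 ≤ addClosure 𝒰 := fun X hX =>
  addClosure_iff.2 ⟨Unit, inferInstance, fun _ => X, fun _ => 𝟙 X, fun _ => 𝟙 X,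
    fun _ => hX, by simp⟩

theorem addClosure_biprod {𝒰 : ObjectProperty C} {X Y : C} (hX : addClosure 𝒰 X)
    (hY : addClosure 𝒰 Y) : addClosure 𝒰 (X ⊞ Y) := by
  obtain ⟨ι, _, f, a, b, hf, h⟩ := addClosure_iff.1 hX
  obtain ⟨κ, _, g, c, d, hg, k⟩ := addClosure_iff.1 hY
  refine addClosure_iff.2 ⟨ι ⊕ κ, inferInstance, Sum.elim f g,
    Sum.rec (fun i => biprod.fst ≫ a i) (fun i => biprod.snd ≫ c i),
    Sum.rec (fun i => b i ≫ biprod.inl) (fun i => d i ≫ biprod.inr), ?_, ?_⟩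
  · rintro (i | i)
    exacts [hf i, hg i]
  · have h₁ : ∑ i, (biprod.fst ≫ a i) ≫ b i ≫ biprod.inl =
        (biprod.fst ≫ biprod.inl : X ⊞ Y ⟶ X ⊞ Y) := by
      simpa [Preadditive.comp_sum, Preadditive.sum_comp] using
        congrArg (fun k => (biprod.fst : X ⊞ Y ⟶ X) ≫ k ≫ (biprod.inl : X ⟶ X ⊞ Y)) h
    have h₂ : ∑ i, (biprod.snd ≫ c i) ≫ d i ≫ biprod.inr =
        (biprod.snd ≫ biprod.inr : X ⊞ Y ⟶ X ⊞ Y) := by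
      simpa [Preadditive.comp_sum, Preadditive.sum_comp] using
        congrArg (fun k => (biprod.snd : X ⊞ Y ⟶ Y) ≫ k ≫ (biprod.inr : Y ⟶ X ⊞ Y)) k
    rw [Fintype.sum_sum_type]
    exact (congrArg₂ (· + ·) h₁ h₂).trans biprod.total

/-- Splitting off the first summand of a finite biproduct reduces everything to binary sums,
retracts and zero objects. -/
theorem addClosure_le {𝒰 𝒬 : ObjectProperty C} (h : 𝒰 ≤ 𝒬)
    (retract : ∀ {X Y : C}, Retract X Y → 𝒬 Y → 𝒬 X)
    (sum : ∀ {X Y : C}, 𝒬 X → 𝒬 Y → 𝒬 (X ⊞ Y)) (zero : ∀ {X : C}, IsZero X → 𝒬 X) :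
    addClosure 𝒰 ≤ 𝒬 := by
  rintro X ⟨n, f, hf, ⟨r⟩⟩
  refine retract r ?_
  clear r
  induction n with
  | zero =>
    refine zero ((IsZero.iff_id_eq_zero _).2 ?_)
    ext i
    exact i.elim0
  | succ n ih =>
    refine retract ⟨biprod.lift (biproduct.π f 0) (biproduct.lift fun i : Fin n =>
      biproduct.π f i.succ),
      biprod.desc (biproduct.ι f 0) (biproduct.desc fun i : Fin n => biproduct.ι f i.succ), ?_⟩
      (sum (h _ (hf 0)) (ih (fun i => f i.succ) fun i => hf _))
    rw [biprod.lift_desc, biproduct.lift_desc, ← Fin.sum_univ_succ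
      (f := fun i => biproduct.π f i ≫ biproduct.ι f i), biproduct.total]

theorem addClosure_le_addClosure {𝒰 𝒱 : ObjectProperty C} (h : 𝒰 ≤ addClosure 𝒱) :
    addClosure 𝒰 ≤ addClosure 𝒱 :=
  addClosure_le h addClosure_of_retract addClosure_biprod addClosure_of_isZero

theorem addObj_self (U : C) : addObj U U :=
  le_addClosure _ _ ((ObjectProperty.singleton_iff _ _).2 rfl)

theorem addObj_le {U V : C} (h : addObj V U) : addObj U ≤ addObj V :=
  addClosure_le_addClosure (by rwa [ObjectProperty.singleton_le_iff])

theorem addObj_le_biprod_left (U V : C) : addObj U ≤ addObj (U ⊞ V) :=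
  addObj_le (addClosure_of_retract ⟨biprod.inl, biprod.fst, by simp⟩ (addObj_self _))

theorem addObj_le_biprod_right (U V : C) : addObj V ≤ addObj (U ⊞ V) :=
  addObj_le (addClosure_of_retract ⟨biprod.inr, biprod.snd, by simp⟩ (addObj_self _))

/-! ### Extensions -/

/-- There is a short exact sequence `0 → A → X → B → 0`. -/
def IsExtension (A X B : C) : Prop :=
  ∃ (f : A ⟶ X) (g : X ⟶ B) (w : f ≫ g = 0), (ShortComplex.mk f g w).ShortExact

theorem _root_.CategoryTheory.ShortComplex.ShortExact.isExtension {S : ShortComplex C}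
    (h : S.ShortExact) : IsExtension S.X₁ S.X₂ S.X₃ :=
  ⟨S.f, S.g, S.zero, h⟩

theorem IsExtension.of_iso {A X B A' X' B' : C} (h : IsExtension A X B) (a : A ≅ A') (x : X ≅ X')
    (b : B ≅ B') : IsExtension A' X' B' := by
  obtain ⟨f, g, w, h⟩ := h
  refine ⟨a.inv ≫ f ≫ x.hom, x.inv ≫ g ≫ b.hom, by simp [reassoc_of% w], ?_⟩
  exact ShortComplex.shortExact_of_iso (ShortComplex.isoMk a x b (by simp) (by simp)) h

theorem isExtension_of_kernel {A X B : C} (f : A ⟶ X) (g : X ⟶ B) (w : f ≫ g = 0) [Mono f] [Epi g]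
    (h : ∀ {W : C} (k : W ⟶ X), k ≫ g = 0 → ∃ l : W ⟶ A, l ≫ f = k) :
    (ShortComplex.mk f g w).ShortExact := by
  choose l hl using @h
  exact ⟨ShortComplex.exact_of_f_is_kernel _ (KernelFork.IsLimit.ofι' f w fun k hk =>
    ⟨l k hk, hl k hk⟩)⟩

theorem isExtension_of_cokernel {A X B : C} (f : A ⟶ X) (g : X ⟶ B) (w : f ≫ g = 0) [Mono f]
    [Epi g] (h : ∀ {W : C} (k : X ⟶ W), f ≫ k = 0 → ∃ l : B ⟶ W, g ≫ l = k) :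
    (ShortComplex.mk f g w).ShortExact := by
  choose l hl using @h
  exact ⟨ShortComplex.exact_of_g_is_cokernel _
    (CokernelCofork.IsColimit.ofπ' g w fun k hk => ⟨l k hk, hl k hk⟩)⟩

theorem exists_lift_of_shortExact {S : ShortComplex C} (hS : S.ShortExact) {W : C} (k : W ⟶ S.X₂)
    (hk : k ≫ S.g = 0) : ∃ l : W ⟶ S.X₁, l ≫ S.f = k :=
  have := hS.mono_f
  ⟨hS.exact.lift k hk, hS.exact.lift_f k hk⟩

theorem exists_desc_of_shortExact {S : ShortComplex C} (hS : S.ShortExact) {W : C} (k : S.X₂ ⟶ W)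
    (hk : S.f ≫ k = 0) : ∃ l : S.X₃ ⟶ W, S.g ≫ l = k :=
  have := hS.epi_g
  ⟨hS.exact.desc k hk, hS.exact.g_desc k hk⟩

theorem isExtension_zero_left {Z : C} (hZ : IsZero Z) (X : C) : IsExtension Z X X := by
  have : Mono (0 : Z ⟶ X) := ⟨fun _ _ _ => hZ.eq_of_tgt _ _⟩
  exact ⟨0, 𝟙 X, by simp, isExtension_of_cokernel _ _ _ fun k _ => ⟨k, by simp⟩⟩

theorem isExtension_zero_right {Z : C} (hZ : IsZero Z) (X : C) : IsExtension X X Z := by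
  have : Epi (0 : X ⟶ Z) := ⟨fun _ _ _ => hZ.eq_of_src _ _⟩
  exact ⟨𝟙 X, 0, by simp, isExtension_of_kernel _ _ _ fun k _ => ⟨k, by simp⟩⟩

theorem IsExtension.nonempty_iso_of_isZero_right {A X B : C} (h : IsExtension A X B)
    (hB : IsZero B) : Nonempty (A ≅ X) := by
  obtain ⟨f, g, w, h⟩ := h
  have := (h.isIso_f_iff).2 hB
  exact ⟨asIso f⟩

theorem IsExtension.nonempty_iso_of_isZero_left {A X B : C} (h : IsExtension A X B)
    (hA : IsZero A) : Nonempty (X ≅ B) := by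
  obtain ⟨f, g, w, h⟩ := h
  have := (h.isIso_g_iff).2 hA
  exact ⟨asIso g⟩

theorem IsExtension.biprod {A X B A' X' B' : C} (h : IsExtension A X B)
    (h' : IsExtension A' X' B') : IsExtension (A ⊞ A') (X ⊞ X') (B ⊞ B') := by
  obtain ⟨f, g, w, h⟩ := h
  obtain ⟨f', g', w', h'⟩ := h'
  have : Mono f := h.mono_f
  have : Mono f' := h'.mono_f
  have : Epi g := h.epi_g
  have : Epi g' := h'.epi_g
  refine ⟨biprod.map f f', biprod.map g g', by ext <;> simp [w, w'],
    isExtension_of_kernel _ _ _ fun k hk => ?_⟩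
  obtain ⟨l, hl⟩ := exists_lift_of_shortExact h (k ≫ biprod.fst)
    (by simpa using congrArg (· ≫ biprod.fst) hk)
  obtain ⟨l', hl'⟩ := exists_lift_of_shortExact h' (k ≫ biprod.snd)
    (by simpa using congrArg (· ≫ biprod.snd) hk)
  exact ⟨biprod.lift l l', by ext <;> simp_all⟩

/-- Pulling back a short exact sequence. -/
theorem exists_shortExact_of_isPullback {K X Y Z P : C} {f : K ⟶ X} {g : X ⟶ Y} {w : f ≫ g = 0}
    (hS : (ShortComplex.mk f g w).ShortExact) {h : Z ⟶ Y} {p : P ⟶ X} {q : P ⟶ Z}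
    (sq : IsPullback p q g h) :
    ∃ (k : K ⟶ P) (w' : k ≫ q = 0), k ≫ p = f ∧ (ShortComplex.mk k q w').ShortExact := by
  have : Epi g := hS.epi_g
  have : Mono f := hS.mono_f
  have : Epi q := by
    rw [← sq.isoPullback_hom_snd]
    infer_instance
  have hk : sq.lift f 0 (by simp [w]) ≫ p = f := sq.lift_fst _ _ _
  have : Mono (sq.lift f 0 (by simp [w])) := by
    have : Mono (sq.lift f 0 (by simp [w]) ≫ p) := by rwa [hk]
    exact mono_of_mono _ p
  refine ⟨sq.lift f 0 _, sq.lift_snd _ _ _, hk,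
    isExtension_of_kernel _ _ _ fun k hk => ?_⟩
  obtain ⟨l, hl⟩ := exists_lift_of_shortExact hS (k ≫ p) (by
    change (k ≫ p) ≫ g = 0
    rw [Category.assoc, sq.w, reassoc_of% hk, zero_comp])
  exact ⟨l, sq.hom_ext (by simpa using hl) (by simp [hk])⟩

/-- Pushing out a short exact sequence. -/
theorem exists_shortExact_of_isPushout {A X B Z P : C} {f : A ⟶ X} {g : X ⟶ B} {w : f ≫ g = 0}
    (hS : (ShortComplex.mk f g w).ShortExact) {h : A ⟶ Z} {p : X ⟶ P} {q : Z ⟶ P}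
    (sq : IsPushout f h p q) :
    ∃ (k : P ⟶ B) (w' : q ≫ k = 0), p ≫ k = g ∧ (ShortComplex.mk q k w').ShortExact := by
  have : Epi g := hS.epi_g
  have : Mono f := hS.mono_f
  have : Mono q := by
    rw [← sq.inr_isoPushout_inv]
    infer_instance
  have hk : p ≫ sq.desc g 0 (by simp [w]) = g := sq.inl_desc _ _ _
  have : Epi (sq.desc g 0 (by simp [w])) := by
    have : Epi (p ≫ sq.desc g 0 (by simp [w])) := by rwa [hk]
    exact epi_of_epi p _
  refine ⟨sq.desc g 0 _, sq.inr_desc _ _ _, hk,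
    isExtension_of_cokernel _ _ _ fun k hk => ?_⟩
  obtain ⟨l, hl⟩ := exists_desc_of_shortExact hS (p ≫ k) (by
    change f ≫ p ≫ k = 0
    rw [sq.w_assoc, hk, comp_zero])
  exact ⟨l, sq.hom_ext (by simpa using hl) (by simp [hk])⟩

/-- If `A` is a subobject of `X` and `U` a subobject of `A`, then `A / U` is a subobject
of `X / U`. -/
theorem IsExtension.assoc {U A V X B : C} (h : IsExtension U A V) (h' : IsExtension A X B) :
    ∃ Y : C, IsExtension U X Y ∧ IsExtension V Y B := by
  obtain ⟨u, p, w, h⟩ := h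
  obtain ⟨f, g, w', h'⟩ := h'
  have : Mono u := h.mono_f
  have : Epi p := h.epi_g
  have : Mono f := h'.mono_f
  have sq := IsPushout.of_hasPushout f p
  obtain ⟨k, w₁, -, hk⟩ := exists_shortExact_of_isPushout h' sq
  refine ⟨_, ⟨u ≫ f, pushout.inl f p, ?_, ?_⟩, ⟨_, _, _, hk⟩⟩
  · rw [Category.assoc, sq.w, reassoc_of% w, zero_comp]
  · refine isExtension_of_cokernel _ _ _ fun {W} k hk => ?_
    obtain ⟨l, hl⟩ := exists_desc_of_shortExact h (f ≫ k) (by simpa using hk)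
    exact ⟨sq.desc k l hl.symm, sq.inl_desc _ _ _⟩

/-- The kernel of a composition of two epimorphisms is an extension of their kernels. -/
theorem IsExtension.comp {A W Y B X : C} (h : IsExtension A W Y) (h' : IsExtension B Y X) :
    ∃ Z : C, IsExtension A Z B ∧ IsExtension Z W X := by
  obtain ⟨f, g, w, h⟩ := h
  obtain ⟨i, p, w', h'⟩ := h'
  have : Epi g := h.epi_g
  have : Epi p := h'.epi_g
  have : Mono i := h'.mono_f
  have sq := IsPullback.of_hasPullback g i
  obtain ⟨k, w₁, -, hk⟩ := exists_shortExact_of_isPullback h sq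
  refine ⟨_, ⟨_, _, _, hk⟩, ⟨pullback.fst g i, g ≫ p, ?_, ?_⟩⟩
  · rw [sq.w_assoc, w', comp_zero]
  · refine isExtension_of_kernel _ _ _ fun {W} k hk => ?_
    obtain ⟨l, hl⟩ := exists_lift_of_shortExact h' (k ≫ g) (by simpa using hk)
    exact ⟨sq.lift k l hl.symm, sq.lift_fst _ _ _⟩

/-- If `A → A'` admits a retraction, then an extension of `B` by `A` is a retract of an extension
of `B` by `A'`. -/
theorem IsExtension.exists_retract {A A' X B : C} (h : IsExtension A X B) (r : Retract A A') :
    ∃ X' : C, IsExtension A' X' B ∧ Nonempty (Retract X X') := by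
  obtain ⟨f, g, w, h⟩ := h
  have sq := IsPushout.of_hasPushout f r.i
  obtain ⟨k, w₁, -, hk⟩ := exists_shortExact_of_isPushout h sq
  exact ⟨_, ⟨_, _, _, hk⟩, ⟨⟨pushout.inl f r.i, sq.desc (𝟙 X) (r.r ≫ f) (by simp), by simp⟩⟩⟩

/-! ### Extension dimension -/

theorem extPower_one (T : C) : extPower T 1 = addObj T := rfl

theorem extPower_add_two (T : C) (n : ℕ) :
    extPower T (n + 2) = extProduct (addObj T) (extPower T (n + 1)) := rfl

theorem exists_extPower_eq_addClosure (T : C) (n : ℕ) :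
    ∃ 𝒰, extPower T (n + 1) = addClosure 𝒰 := by
  cases n
  exacts [⟨_, extPower_one T⟩, ⟨_, extPower_add_two T _⟩]

theorem extPower_of_retract {T : C} {n : ℕ} {X Y : C} (r : Retract X Y)
    (h : extPower T (n + 1) Y) : extPower T (n + 1) X := by
  obtain ⟨𝒰, h𝒰⟩ := exists_extPower_eq_addClosure T n
  rw [h𝒰] at h ⊢
  exact addClosure_of_retract r h

/-- Induction on `a`, peeling one `add T` layer off the subobject `A`. Since `[T]_{a+2}` includes
summands of finite sums, `key` first shows that each member is a retract of a single genuine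
extension. -/
theorem extPower_of_isExtension {T : C} {a b : ℕ} {A X B : C} (hA : extPower T (a + 1) A)
    (hB : extPower T (b + 1) B) (h : IsExtension A X B) : extPower T (a + 1 + (b + 1)) X := by
  induction a generalizing A X B with
  | zero =>
    obtain ⟨f, g, w, h⟩ := h
    rw [show 0 + 1 + (b + 1) = b + 2 by lia]
    rw [extPower_add_two]
    exact le_addClosure _ _ ⟨_, h, hA, hB, ⟨Iso.refl _⟩⟩
  | succ a ih =>
    obtain ⟨𝒰, h𝒰⟩ := exists_extPower_eq_addClosure T a
    have key : extPower T (a + 2) ≤ fun X => ∃ Y U V, Nonempty (Retract X Y) ∧ addObj T U ∧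
        extPower T (a + 1) V ∧ IsExtension U Y V := by
      rw [extPower_add_two]
      refine addClosure_le ?_ ?_ ?_ ?_
      · rintro X ⟨S, hS, h₁, h₃, ⟨e⟩⟩
        exact ⟨S.X₂, _, _, ⟨.ofIso e.symm⟩, h₁, h₃, hS.isExtension⟩
      · rintro X Y r ⟨Y', U, V, ⟨s⟩, h⟩
        exact ⟨Y', U, V, ⟨r.trans s⟩, h⟩
      · rintro X X' ⟨Y, U, V, ⟨r⟩, h₁, h₂, h₃⟩ ⟨Y', U', V', ⟨r'⟩, h₁', h₂', h₃'⟩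
        refine ⟨Y ⊞ Y', U ⊞ U', V ⊞ V', ⟨⟨biprod.map r.i r'.i, biprod.map r.r r'.r, ?_⟩⟩,
          addClosure_biprod h₁ h₁', ?_, h₃.biprod h₃'⟩
        · ext <;> simp
        · rw [h𝒰] at h₂ h₂' ⊢
          exact addClosure_biprod h₂ h₂'
      · intro X hX
        refine ⟨X, X, X, ⟨.refl _⟩, addClosure_of_isZero hX, ?_, isExtension_zero_left hX _⟩
        rw [h𝒰]
        exact addClosure_of_isZero hX
    obtain ⟨A', U, V, ⟨r⟩, hU, hV, hA'⟩ := key _ hA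
    -- Pushing out along `A → A'` replaces `A` by the genuine extension `A'` and makes `X` a retract
    -- of `X'`; then `X' / U` is an extension of `B` by `V`, and the induction hypothesis applies to
    -- it.
    obtain ⟨X', hX', ⟨s⟩⟩ := h.exists_retract r
    obtain ⟨Y, hY, hY'⟩ := hA'.assoc hX'
    rw [show a + 1 + 1 + (b + 1) = a + 1 + b + 1 + 1 by lia]
    refine extPower_of_retract s ?_
    have := ih hV hB hY'
    obtain ⟨f, g, w, hY⟩ := hY
    rw [extPower_add_two]
    exact le_addClosure _ _ ⟨_, hY, hU, this, ⟨Iso.refl _⟩⟩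

end Abelian

/-! ### Extension dimension under exact functors. -/

section Functor

variable {C D : Type u} [Category.{v} C] [Category.{v} D] [Abelian C] [Abelian D]

attribute [local instance] Abelian.hasFiniteBiproducts

theorem addClosure_map (F : C ⥤ D) [F.Additive] {𝒰 : ObjectProperty C} {𝒱 : ObjectProperty D}
    (h : 𝒰 ≤ 𝒱.inverseImage F) {X : C} (hX : addClosure 𝒰 X) : addClosure 𝒱 (F.obj X) := by
  obtain ⟨ι, _, f, a, b, hf, hs⟩ := addClosure_iff.1 hX
  refine addClosure_iff.2 ⟨ι, inferInstance, fun i => F.obj (f i), fun i => F.map (a i),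
    fun i => F.map (b i), fun i => h _ (hf i), ?_⟩
  simpa using congrArg F.map hs

theorem addObj_map (F : C ⥤ D) [F.Additive] {T X : C} (hX : addObj T X) :
    addObj (F.obj T) (F.obj X) :=
  addClosure_map F (by rw [ObjectProperty.singleton_le_iff]
                       exact (ObjectProperty.singleton_iff _ _).2 rfl) hX

theorem IsExtension.map (F : C ⥤ D) [F.Additive] [PreservesFiniteLimits F]
    [PreservesFiniteColimits F] {A X B : C} (h : IsExtension A X B) :
    IsExtension (F.obj A) (F.obj X) (F.obj B) := by
  obtain ⟨f, g, w, h⟩ := h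
  exact ⟨_, _, _, h.map_of_exact F⟩

theorem extPower_map (F : C ⥤ D) [F.Additive] [PreservesFiniteLimits F]
    [PreservesFiniteColimits F] {T X : C} {n : ℕ} (hX : extPower T (n + 1) X) :
    extPower (F.obj T) (n + 1) (F.obj X) := by
  induction n generalizing X with
  | zero => exact addObj_map F hX
  | succ n ih =>
    rw [extPower_add_two] at hX ⊢
    refine addClosure_map F ?_ hX
    rintro A ⟨S, hS, h₁, h₃, ⟨e⟩⟩
    exact ⟨S.map F, hS.map_of_exact F, addObj_map F h₁, ih h₃, ⟨F.mapIso e⟩⟩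

theorem extensionDimension_le_of_section (F : C ⥤ D) [F.Additive] [PreservesFiniteLimits F]
    [PreservesFiniteColimits F] (G : D ⥤ C) (e : G ⋙ F ≅ 𝟭 D) :
    extensionDimension D ≤ extensionDimension C := by
  refine le_iInf₂ fun n ⟨T, hT⟩ => iInf₂_le n ⟨F.obj T, fun X => ?_⟩
  exact extPower_of_retract (.ofIso (e.app X).symm) (extPower_map F (hT (G.obj X)))

theorem extensionDimension_le_of_extension (I : D ⥤ C) [I.Additive] [PreservesFiniteLimits I]
    [PreservesFiniteColimits I] (A B : C → D)
    (h : ∀ X, IsExtension (I.obj (A X)) X (I.obj (B X))) :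
    extensionDimension C ≤ (2 : ℕ) * (extensionDimension D + 1) - 1 := by
  refine le_mul_iInf_add_one_sub_one (by norm_num) ?_
  rintro m ⟨T, hT⟩
  refine iInf₂_le (2 * (m + 1) - 1) ⟨I.obj T, fun X => ?_⟩
  rw [show 2 * (m + 1) - 1 + 1 = m + 1 + (m + 1) by lia]
  exact extPower_of_isExtension (extPower_map I (hT _)) (extPower_map I (hT _)) (h X)

end Functor

/-! ### Trading resolutions for filtrations by taking syzygies. -/

/-! ### Syzygies -/

section Syzygy

open scoped ZeroObject

variable {C : Type u} [Category.{v} C] [Abelian C]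

attribute [local instance] Abelian.hasFiniteBiproducts

/-- The objects which have a first syzygy in `𝒰`. -/
def withSyzygyIn (𝒰 : ObjectProperty C) : ObjectProperty C := fun X =>
  ∃ K P : C, Projective P ∧ IsExtension K P X ∧ 𝒰 K

/-- The objects `X` that sit in a short exact sequence `0 → A → X → B → 0` with `A` in `𝒰` and
`B` in `𝒱`. -/
def extensionsOf (𝒰 𝒱 : ObjectProperty C) : ObjectProperty C := fun X =>
  ∃ A B : C, 𝒰 A ∧ 𝒱 B ∧ IsExtension A X B

/-- The objects that are obtained from `0` by `k` extensions by objects of `add V`. -/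
def layers (V : C) : ℕ → ObjectProperty C
  | 0 => fun X => IsZero X
  | k + 1 => extensionsOf (addObj V) (layers V k)

theorem withSyzygyIn_mono {𝒰 𝒱 : ObjectProperty C} (h : 𝒰 ≤ 𝒱) :
    withSyzygyIn 𝒰 ≤ withSyzygyIn 𝒱 := by
  rintro X ⟨K, P, hP, hX, hK⟩
  exact ⟨K, P, hP, hX, h _ hK⟩

theorem withSyzygyIn_iterate_mono {𝒰 𝒱 : ObjectProperty C} (h : 𝒰 ≤ 𝒱) (t : ℕ) :
    withSyzygyIn^[t] 𝒰 ≤ withSyzygyIn^[t] 𝒱 := by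
  induction t with
  | zero => exact h
  | succ t ih =>
    rw [Function.iterate_succ_apply', Function.iterate_succ_apply']
    exact withSyzygyIn_mono ih

theorem withSyzygyIn_iterate_iff {𝒰 : ObjectProperty C} {t : ℕ}
    (h𝒰 : ∀ {K L : C}, (K ≅ L) → 𝒰 K → 𝒰 L) {X : C} :
    (withSyzygyIn^[t] 𝒰) X ↔ ∃ K, IsSyzygy t X K ∧ 𝒰 K := by
  induction t generalizing X with
  | zero => exact ⟨fun h => ⟨X, ⟨Iso.refl _⟩, h⟩, fun ⟨K, ⟨e⟩, h⟩ => h𝒰 e h⟩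
  | succ t ih =>
    rw [Function.iterate_succ_apply']
    constructor
    · rintro ⟨Y, P, hP, ⟨f, g, w, h⟩, hY⟩
      obtain ⟨K, hK, hK'⟩ := ih.1 hY
      exact ⟨K, ⟨_, h, hP, ⟨Iso.refl _⟩, hK⟩, hK'⟩
    · rintro ⟨K, ⟨S, hS, hP, ⟨e⟩, hK⟩, hK'⟩
      exact ⟨S.X₁, S.X₂, hP, hS.isExtension.of_iso (Iso.refl _) (Iso.refl _) e, ih.2 ⟨K, hK, hK'⟩⟩

theorem extensionsOf_mono {𝒰 𝒰' 𝒱 𝒱' : ObjectProperty C} (h : 𝒰 ≤ 𝒰') (h' : 𝒱 ≤ 𝒱') :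
    extensionsOf 𝒰 𝒱 ≤ extensionsOf 𝒰' 𝒱' := by
  rintro X ⟨A, B, hA, hB, hX⟩
  exact ⟨A, B, h _ hA, h' _ hB, hX⟩

theorem IsExtension.nonempty_iso_biprod {A X B : C} (h : IsExtension A X B) [Projective B] :
    Nonempty (X ≅ A ⊞ B) := by
  obtain ⟨f, g, w, h⟩ := h
  exact ⟨(ShortComplex.ShortExact.splittingOfProjective h).isoBinaryBiproduct⟩

/-- The pullback of `X → B ← P` maps onto `P` with kernel `A`, so it splits as `A ⊞ P`; its
projection to `X` has kernel `K`. -/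
theorem IsExtension.rotate {A X B K P : C} (h : IsExtension A X B) (h' : IsExtension K P B)
    [Projective P] : IsExtension K (A ⊞ P) X := by
  obtain ⟨f, g, w, h⟩ := h
  obtain ⟨f', g', w', h'⟩ := h'
  have sq := IsPullback.of_hasPullback g g'
  obtain ⟨k, hk, -, h₁⟩ := exists_shortExact_of_isPullback h sq
  obtain ⟨k', hk', -, h₂⟩ := exists_shortExact_of_isPullback h' sq.flip
  obtain ⟨e⟩ := IsExtension.nonempty_iso_biprod ⟨_, _, _, h₁⟩
  exact IsExtension.of_iso ⟨_, _, _, h₂⟩ (Iso.refl _) e (Iso.refl _)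

/-- The horseshoe lemma. -/
theorem IsExtension.horseshoe {A X B K P L Q : C} (h : IsExtension A X B) (hA : IsExtension K P A)
    (hB : IsExtension L Q B) [Projective P] [Projective Q] :
    ∃ Z W : C, Projective W ∧ IsExtension Z W X ∧ IsExtension K Z L := by
  -- Rotation covers `X` by `A ⊞ Q` with kernel `L`. Covering `A` by `P` then covers `A ⊞ Q` by `P ⊞
  -- Q` with kernel `K`, and the kernel of the composite is the desired `Z`.
  have hX := h.rotate hB
  have hW : IsExtension K (P ⊞ Q) (A ⊞ Q) :=
    (hA.biprod (isExtension_zero_left (isZero_zero C) Q)).of_iso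
      (isoBiprodZero (isZero_zero C)).symm (Iso.refl _) (Iso.refl _)
  obtain ⟨Z, h₁, h₂⟩ := hW.comp hX
  exact ⟨Z, _, inferInstance, h₂, h₁⟩

theorem extensionsOf_withSyzygyIn (𝒰 𝒱 : ObjectProperty C) :
    extensionsOf (withSyzygyIn 𝒰) (withSyzygyIn 𝒱) ≤ withSyzygyIn (extensionsOf 𝒰 𝒱) := by
  rintro X ⟨A, B, ⟨K, P, hP, hA, hK⟩, ⟨L, Q, hQ, hB, hL⟩, h⟩
  obtain ⟨Z, W, hW, hX, hZ⟩ := h.horseshoe hA hB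
  exact ⟨Z, W, hW, hX, K, L, hK, hL, hZ⟩

theorem extensionsOf_withSyzygyIn_iterate (𝒰 𝒱 : ObjectProperty C) (t : ℕ) :
    extensionsOf (withSyzygyIn^[t] 𝒰) (withSyzygyIn^[t] 𝒱) ≤
      withSyzygyIn^[t] (extensionsOf 𝒰 𝒱) := by
  induction t with
  | zero => exact le_rfl
  | succ t ih =>
    simp only [Function.iterate_succ_apply']
    exact (extensionsOf_withSyzygyIn _ _).trans (withSyzygyIn_mono ih)

theorem layers_mono {V W : C} (h : addObj V ≤ addObj W) (k : ℕ) : layers V k ≤ layers W k := by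
  induction k with
  | zero => exact le_rfl
  | succ k ih => exact extensionsOf_mono h ih

theorem layers_le_succ (V : C) (k : ℕ) : layers V k ≤ layers V (k + 1) := fun X hX =>
  ⟨0, X, addClosure_of_isZero (isZero_zero C), hX, isExtension_zero_left (isZero_zero C) X⟩

theorem layers_of_iso {V : C} {k : ℕ} {X Y : C} (e : X ≅ Y) (h : layers V k X) : layers V k Y := by
  cases k with
  | zero => exact IsZero.of_iso h e.symm
  | succ k =>
    obtain ⟨A, B, hA, hB, h⟩ := h
    exact ⟨A, B, hA, hB, h.of_iso (Iso.refl _) e (Iso.refl _)⟩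

theorem addObj_le_layers (V : C) (k : ℕ) : addObj V ≤ layers V (k + 1) := by
  induction k with
  | zero => exact fun X hX => ⟨X, 0, hX, isZero_zero C, isExtension_zero_right (isZero_zero C) X⟩
  | succ k ih => exact ih.trans (layers_le_succ V _)

theorem extensionsOf_layers (V : C) (a b : ℕ) :
    extensionsOf (layers V a) (layers V b) ≤ layers V (a + b) := by
  induction a with
  | zero =>
    rintro X ⟨A, B, hA, hB, h⟩
    obtain ⟨e⟩ := h.nonempty_iso_of_isZero_left hA
    rw [zero_add]
    exact layers_of_iso e.symm hB
  | succ a ih =>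
    rintro X ⟨A, B, ⟨A', A'', hA', hA'', hA⟩, hB, h⟩
    obtain ⟨Y, hY, hY'⟩ := hA.assoc h
    rw [Nat.succ_add]
    exact ⟨A', Y, hA', ih _ ⟨A'', B, hA'', hB, hY'⟩, hY⟩

theorem hasAddResolution_of_iso {U : C} {m : ℕ} {X Y : C} (e : X ≅ Y)
    (h : HasAddResolution U m X) : HasAddResolution U m Y := by
  cases m with
  | zero => exact addClosure_of_retract (.ofIso e.symm) h
  | succ m =>
    obtain ⟨S, hS, h₂, ⟨e'⟩, h₁⟩ := h
    exact ⟨S, hS, h₂, ⟨e' ≪≫ e⟩, h₁⟩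

theorem hasAddResolution_succ_iff {U X : C} {m : ℕ} : HasAddResolution U (m + 1) X ↔
    ∃ K A, addObj U A ∧ HasAddResolution U m K ∧ IsExtension K A X := by
  constructor
  · rintro ⟨S, hS, h₂, ⟨e⟩, h₁⟩
    exact ⟨_, _, h₂, h₁, hS.isExtension.of_iso (Iso.refl _) (Iso.refl _) e⟩
  · rintro ⟨K, A, hA, hK, f, g, w, h⟩
    exact ⟨_, h, hA, ⟨Iso.refl _⟩, hK⟩

theorem hasAddResolution_mono {V W : C} (h : addObj V ≤ addObj W) {m : ℕ} {X : C}
    (hX : HasAddResolution V m X) : HasAddResolution W m X := by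
  induction m generalizing X with
  | zero => exact h _ hX
  | succ m ih =>
    obtain ⟨K, A, hA, hK, hX⟩ := hasAddResolution_succ_iff.1 hX
    exact hasAddResolution_succ_iff.2 ⟨K, A, h _ hA, ih hK, hX⟩

/-- A form of Schanuel's lemma for retracts: syzygies depend on the chosen cover only up to
projectives, and a retraction lifts to the covers up to a map that factors through the syzygy `K`.
-/
theorem nonempty_retract_syzygy {X Y K P L Q : C} (r : Retract X Y) (hX : IsExtension K P X)
    (hY : IsExtension L Q Y) [Projective P] [Projective Q] : Nonempty (Retract K (L ⊞ P)) := by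
  obtain ⟨f, g, w, hX⟩ := hX
  obtain ⟨f', g', w', hY⟩ := hY
  have : Epi g := hX.epi_g
  have : Epi g' := hY.epi_g
  have : Mono f := hX.mono_f
  let a : P ⟶ Q := Projective.factorThru (g ≫ r.i) g'
  have ha : a ≫ g' = g ≫ r.i := Projective.factorThru_comp _ _
  let b : Q ⟶ P := Projective.factorThru (g' ≫ r.r) g
  have hb : b ≫ g = g' ≫ r.r := Projective.factorThru_comp _ _
  obtain ⟨a', ha'⟩ := exists_lift_of_shortExact hY (f ≫ a) (by
    change (f ≫ a) ≫ g' = 0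
    rw [Category.assoc, ha, reassoc_of% w, zero_comp])
  obtain ⟨b', hb'⟩ := exists_lift_of_shortExact hX (f' ≫ b) (by
    change (f' ≫ b) ≫ g = 0
    rw [Category.assoc, hb, reassoc_of% w', zero_comp])
  -- The composite `a ≫ b` lifts the identity of `X`, so its difference from the identity of `P`
  -- lands in `K`; this error term `c` becomes the component `P ⟶ K` of the retraction.
  obtain ⟨c, hc⟩ := exists_lift_of_shortExact hX (𝟙 P - a ≫ b) (by
    change (𝟙 P - a ≫ b) ≫ g = 0
    rw [Preadditive.sub_comp, Category.assoc, hb, reassoc_of% ha, r.retract]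
    simp)
  dsimp only at a' b' c ha' hb' hc
  refine ⟨⟨biprod.lift a' f, biprod.desc b' c, ?_⟩⟩
  rw [biprod.lift_desc, ← cancel_mono f, Preadditive.add_comp, Category.assoc, Category.assoc, hb',
    hc, reassoc_of% ha', Preadditive.comp_sub]
  simp

theorem projective_of_addObj {G P : C} [Projective G] (h : addObj G P) : Projective P := by
  refine addClosure_le (𝒬 := fun P => Projective P) ?_ ?_ ?_ ?_ P h
  · rw [ObjectProperty.singleton_le_iff]
    infer_instance
  · exact fun r h => r.projective
  · exact fun _ _ => inferInstance
  · exact fun h => h.projective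

/-- `G` is a projective generator for finite direct sums. -/
structure IsProjectiveGenerator (G : C) : Prop where
  projective : Projective G
  exists_epi : ∀ X : C, ∃ (P : C) (p : P ⟶ X), addObj G P ∧ Epi p

namespace IsProjectiveGenerator

variable {G : C}

theorem addObj_projective (hG : IsProjectiveGenerator G) {P : C} (h : addObj G P) :
    Projective P :=
  have := hG.projective
  projective_of_addObj h

theorem addObj_of_projective (hG : IsProjectiveGenerator G) (P : C) [Projective P] :
    addObj G P := by
  obtain ⟨Q, p, hQ, _⟩ := hG.exists_epi P
  exact addClosure_of_retract ⟨Projective.factorThru (𝟙 P) p, p, by simp⟩ hQ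

theorem exists_syzygy (hG : IsProjectiveGenerator G) (X : C) :
    ∃ K P : C, Projective P ∧ IsExtension K P X := by
  obtain ⟨P, p, hP, _⟩ := hG.exists_epi X
  exact ⟨_, P, hG.addObj_projective hP, kernel.ι p, p, by simp,
    isExtension_of_kernel _ _ _ fun k hk => ⟨kernel.lift p k hk, by simp⟩⟩

/-- All first syzygies of the objects of `add V` belong to `add W` for a suitable `W`. -/
theorem exists_addObj_syzygy (hG : IsProjectiveGenerator G) (V : C) :
    ∃ W : C, addObj G ≤ addObj W ∧ ∀ {X K P : C}, addObj V X → Projective P →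
      IsExtension K P X → addObj W K := by
  obtain ⟨K₀, P₀, hP₀, hV⟩ := hG.exists_syzygy V
  have hGW := addObj_le_biprod_right K₀ G
  -- One good syzygy for each object is enough: the Schanuel comparison then carries membership over
  -- to every syzygy, because `G` is a summand of the object `K₀ ⊞ G`.
  have key : addObj V ≤ withSyzygyIn (addObj (K₀ ⊞ G)) := by
    refine addClosure_le ?_ ?_ ?_ ?_
    · rw [ObjectProperty.singleton_le_iff]
      exact ⟨K₀, P₀, hP₀, hV, addObj_le_biprod_left _ _ _ (addObj_self _)⟩
    · rintro X Y r ⟨L, Q, hQ, hY, hL⟩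
      obtain ⟨K, P, hP, hX⟩ := hG.exists_syzygy X
      obtain ⟨s⟩ := nonempty_retract_syzygy r hX hY
      exact ⟨K, P, hP, hX, addClosure_of_retract s
        (addClosure_biprod hL (hGW _ (hG.addObj_of_projective P)))⟩
    · rintro X Y ⟨K, P, hP, hX, hK⟩ ⟨L, Q, hQ, hY, hL⟩
      exact ⟨_, _, inferInstance, hX.biprod hY, addClosure_biprod hK hL⟩
    · exact fun {X} hX => ⟨X, X, hX.projective, isExtension_zero_left hX X,
        addClosure_of_isZero hX⟩
  refine ⟨K₀ ⊞ G, hGW, fun {X K P} hX hP h => ?_⟩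
  obtain ⟨L, Q, hQ, hY, hL⟩ := key _ hX
  obtain ⟨s⟩ := nonempty_retract_syzygy (.refl X) h hY
  exact addClosure_of_retract s (addClosure_biprod hL (hGW _ (hG.addObj_of_projective P)))

/-- By the horseshoe lemma a syzygy of a filtered object is filtered by syzygies of its layers, so
further syzygies change the generating object but not the number of layers. One `W` serves all `k`.
-/
theorem exists_layers_le_withSyzygyIn (hG : IsProjectiveGenerator G) (V : C) (s : ℕ) :
    ∃ W : C, ∀ k, layers V k ≤ withSyzygyIn^[s] (layers W k) := by
  induction s with
  | zero => exact ⟨V, fun k => le_rfl⟩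
  | succ s ih =>
    obtain ⟨W, hW⟩ := ih
    obtain ⟨W', -, hW'⟩ := hG.exists_addObj_syzygy W
    refine ⟨W', fun k => (hW k).trans ?_⟩
    rw [Function.iterate_succ_apply]
    refine withSyzygyIn_iterate_mono ?_ s
    induction k with
    | zero => exact fun X hX => ⟨X, X, IsZero.projective hX, isExtension_zero_left hX X, hX⟩
    | succ k ih =>
      refine (extensionsOf_mono ?_ ih).trans (extensionsOf_withSyzygyIn _ _)
      intro X hX
      obtain ⟨K, P, hP, h⟩ := hG.exists_syzygy X
      exact ⟨K, P, hP, h, hW' hX hP h⟩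

/-- For `0 → K → A → X → 0`, covering `A` by a projective presents a syzygy of `X` as an extension
of `K` by a syzygy of `A`. Each term of the resolution thus becomes one layer, at the price of one
syzygy. -/
theorem exists_hasAddResolution_le_withSyzygyIn (hG : IsProjectiveGenerator G) (U : C) (m : ℕ) :
    ∃ V : C, HasAddResolution U m ≤ withSyzygyIn^[m] (layers V (m + 1)) := by
  induction m with
  | zero => exact ⟨U, addObj_le_layers U 0⟩
  | succ m ih =>
    obtain ⟨V, hV⟩ := ih
    obtain ⟨U', -, hU'⟩ := hG.exists_addObj_syzygy U
    obtain ⟨U'', hU''⟩ := hG.exists_layers_le_withSyzygyIn U' m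
    refine ⟨U'' ⊞ V, fun X hX => ?_⟩
    obtain ⟨K, A, hA, hK, hX⟩ := hasAddResolution_succ_iff.1 hX
    obtain ⟨L, P, hP, hL⟩ := hG.exists_syzygy A
    obtain ⟨Z, h₁, h₂⟩ := hL.comp hX
    rw [Function.iterate_succ_apply']
    refine ⟨Z, P, hP, h₂, ?_⟩
    have h := extensionsOf_withSyzygyIn_iterate (layers U'' 1) (layers V (m + 1)) m Z
      ⟨L, K, hU'' 1 _ (addObj_le_layers U' 0 _ (hU' hA hP hL)), hV _ hK, h₁⟩
    refine withSyzygyIn_iterate_mono ?_ m _ h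
    refine (extensionsOf_mono (layers_mono (addObj_le_biprod_left _ _) _)
      (layers_mono (addObj_le_biprod_right _ _) _)).trans ((extensionsOf_layers _ _ _).trans ?_)
    rw [Nat.add_comm]

/-- Applying the horseshoe lemma to `0 → K → A → X → 0` gives `0 → L → Z → Y → 0` on syzygies. Since
`Z` is a syzygy of `A`, it lies in `add W`, and the length is unchanged. -/
theorem exists_hasAddResolution_syzygy (hG : IsProjectiveGenerator G) (U : C) (m : ℕ) :
    ∃ W : C, HasAddResolution U m ≤ withSyzygyIn (HasAddResolution W m) := by
  obtain ⟨W, hGW, hW⟩ := hG.exists_addObj_syzygy U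
  refine ⟨W, ?_⟩
  induction m with
  | zero =>
    intro X hX
    obtain ⟨K, P, hP, h⟩ := hG.exists_syzygy X
    exact ⟨K, P, hP, h, hW hX hP h⟩
  | succ m ih =>
    intro X hX
    obtain ⟨K, A, hA, hK, hX⟩ := hasAddResolution_succ_iff.1 hX
    obtain ⟨L, P, hP, hL, hL'⟩ := ih _ hK
    obtain ⟨Y, Q, hQ, hY⟩ := hG.exists_syzygy X
    obtain ⟨Z, R, hR, hZ, hZ'⟩ := hX.horseshoe hL hY
    exact ⟨Y, Q, hQ, hY, hasAddResolution_succ_iff.2 ⟨L, Z, hW hA hR hZ, hL', hZ'⟩⟩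

/-- Rotating `0 → A → X → B → 0` along a projective cover `P` of `B` resolves `X` by `A ⊞ P` with
kernel a syzygy of `B`, which inherits a resolution of the same length as that of `B`. No syzygy of
`X` itself is taken. -/
theorem exists_layers_le_hasAddResolution (hG : IsProjectiveGenerator G) (V : C) (m : ℕ) :
    ∃ W : C, layers V (m + 1) ≤ HasAddResolution W m := by
  induction m with
  | zero =>
    refine ⟨V, ?_⟩
    rintro X ⟨A, B, hA, hB, h⟩
    obtain ⟨e⟩ := h.nonempty_iso_of_isZero_right hB
    exact addClosure_of_retract (.ofIso e.symm) hA
  | succ m ih =>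
    obtain ⟨W, hW⟩ := ih
    obtain ⟨W', hW'⟩ := hG.exists_hasAddResolution_syzygy W m
    refine ⟨(V ⊞ G) ⊞ W', ?_⟩
    rintro X ⟨A, B, hA, hB, h⟩
    obtain ⟨K, P, hP, hK, hK'⟩ := hW' _ (hW _ hB)
    refine hasAddResolution_succ_iff.2 ⟨K, A ⊞ P, addObj_le_biprod_left _ _ _ ?_,
      hasAddResolution_mono (addObj_le_biprod_right _ _) hK', h.rotate hK⟩
    exact addClosure_biprod (addObj_le_biprod_left _ _ _ hA)
      (addObj_le_biprod_right _ _ _ (hG.addObj_of_projective P))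

end IsProjectiveGenerator

theorem isIgusaTodorovCategory_iff {m t : ℕ} : IsIgusaTodorovCategory C m t ↔
    ∃ U : C, ∀ X : C, (withSyzygyIn^[t] (HasAddResolution U m)) X := by
  simp only [withSyzygyIn_iterate_iff hasAddResolution_of_iso, IsIgusaTodorovCategory]

end Syzygy

/-! ### Igusa-Todorov distance under exact functors that preserve projectives. -/

section IgusaTodorov

variable {C D : Type u} [Category.{v} C] [Category.{v} D] [Abelian C] [Abelian D]

attribute [local instance] Abelian.hasFiniteBiproducts

theorem hasAddResolution_map (F : C ⥤ D) [F.Additive] [PreservesFiniteLimits F]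
    [PreservesFiniteColimits F] {U X : C} {m : ℕ} (h : HasAddResolution U m X) :
    HasAddResolution (F.obj U) m (F.obj X) := by
  induction m generalizing X with
  | zero => exact addObj_map F h
  | succ m ih =>
    obtain ⟨K, A, hA, hK, hX⟩ := hasAddResolution_succ_iff.1 h
    exact hasAddResolution_succ_iff.2 ⟨_, _, addObj_map F hA, ih hK, hX.map F⟩

theorem layers_map (F : C ⥤ D) [F.Additive] [PreservesFiniteLimits F]
    [PreservesFiniteColimits F] {V X : C} {k : ℕ} (h : layers V k X) :
    layers (F.obj V) k (F.obj X) := by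
  induction k generalizing X with
  | zero => exact F.map_isZero h
  | succ k ih =>
    obtain ⟨A, B, hA, hB, h⟩ := h
    exact ⟨_, _, addObj_map F hA, ih hB, h.map F⟩

theorem withSyzygyIn_iterate_map (F : C ⥤ D) [F.Additive] [PreservesFiniteLimits F]
    [PreservesFiniteColimits F] [F.PreservesProjectiveObjects] {𝒰 : ObjectProperty C}
    {𝒱 : ObjectProperty D} (h : 𝒰 ≤ 𝒱.inverseImage F) {t : ℕ} {X : C}
    (hX : (withSyzygyIn^[t] 𝒰) X) : (withSyzygyIn^[t] 𝒱) (F.obj X) := by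
  induction t generalizing X with
  | zero => exact h _ hX
  | succ t ih =>
    rw [Function.iterate_succ_apply'] at hX ⊢
    obtain ⟨K, P, hP, hX, hK⟩ := hX
    exact ⟨_, _, F.projective_obj P, hX.map F, ih hK⟩

theorem withSyzygyIn_iterate_of_iso {𝒰 : ObjectProperty C}
    (h𝒰 : ∀ {K L : C}, (K ≅ L) → 𝒰 K → 𝒰 L) {t : ℕ} {X Y : C} (e : X ≅ Y)
    (hX : (withSyzygyIn^[t] 𝒰) X) : (withSyzygyIn^[t] 𝒰) Y := by
  cases t with
  | zero => exact h𝒰 e hX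
  | succ t =>
    rw [Function.iterate_succ_apply'] at hX ⊢
    obtain ⟨K, P, hP, h, hK⟩ := hX
    exact ⟨K, P, hP, h.of_iso (Iso.refl _) (Iso.refl _) e, hK⟩

theorem igusaTodorovDistance_le_of_section (F : C ⥤ D) [F.Additive] [PreservesFiniteLimits F]
    [PreservesFiniteColimits F] [F.PreservesProjectiveObjects] (G : D ⥤ C) (e : G ⋙ F ≅ 𝟭 D) :
    igusaTodorovDistance D ≤ igusaTodorovDistance C := by
  refine le_iInf₂ fun m ⟨t, h⟩ => iInf₂_le m ⟨t, ?_⟩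
  obtain ⟨U, hU⟩ := isIgusaTodorovCategory_iff.1 h
  refine isIgusaTodorovCategory_iff.2 ⟨F.obj U, fun X => ?_⟩
  exact withSyzygyIn_iterate_of_iso hasAddResolution_of_iso (e.app X)
    (withSyzygyIn_iterate_map F (fun _ => hasAddResolution_map F) (hU (G.obj X)))

theorem igusaTodorovDistance_le_of_nilpotent {P : C} (hP : IsProjectiveGenerator P) {Q : D}
    (hQ : IsProjectiveGenerator Q) (F : D ⥤ C) [F.Additive] [PreservesFiniteLimits F]
    [PreservesFiniteColimits F] [F.PreservesProjectiveObjects] (E : C → D) (G : C → C)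
    (h : ∀ X, IsExtension (G X) (F.obj (E X)) X) {n : ℕ} (hn : 1 ≤ n)
    (hG : ∀ X, IsZero (G^[n] X)) :
    igusaTodorovDistance C ≤ n * (igusaTodorovDistance D + 1) - 1 := by
  refine le_mul_iInf_add_one_sub_one hn ?_
  rintro m ⟨t, hm⟩
  refine iInf₂_le (n * (m + 1) - 1) ?_
  obtain ⟨U, hU⟩ := isIgusaTodorovCategory_iff.1 hm
  obtain ⟨V, hV⟩ := hQ.exists_hasAddResolution_le_withSyzygyIn U m
  have hF : ∀ Y, (withSyzygyIn^[t + m] (layers (F.obj V) (m + 1))) (F.obj Y) := fun Y => by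
    refine withSyzygyIn_iterate_map F (fun X => layers_map F (V := V)) ?_
    rw [Function.iterate_add_apply]
    exact withSyzygyIn_iterate_mono hV t _ (hU Y)
  -- Both `T` and `W` must be chosen before `X`. The induction is on the number of applications of
  -- `G` that annihilate `X`.
  have key : ∀ j, ∃ (T : ℕ) (W : C), ∀ X, IsZero (G^[j] X) →
      (withSyzygyIn^[T] (layers W (j * (m + 1)))) X := by
    intro j
    induction j with
    | zero => exact ⟨0, P, fun X hX => by rw [zero_mul]; exact hX⟩
    | succ j ih =>
      obtain ⟨T, W, hW⟩ := ih
      obtain ⟨V', hV'⟩ := hP.exists_layers_le_withSyzygyIn (F.obj V) (T + 1)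
      obtain ⟨W', hW'⟩ := hP.exists_layers_le_withSyzygyIn W (t + m)
      -- The extra `1` aligns the two sides: after its first syzygy, `F.obj (E X)` has `T + (t + m)`
      -- syzygies left to take, the number applied to `G X`.
      refine ⟨T + (t + m) + 1, V' ⊞ W', fun X hX => ?_⟩
      have h₁ : (withSyzygyIn^[T + (t + m) + 1] (layers V' (m + 1))) (F.obj (E X)) := by
        rw [show T + (t + m) + 1 = t + m + (T + 1) by lia, Function.iterate_add_apply]
        exact withSyzygyIn_iterate_mono (hV' _) _ _ (hF _)
      have h₂ : (withSyzygyIn^[T + (t + m)] (layers W' (j * (m + 1)))) (G X) := by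
        rw [Function.iterate_add_apply]
        exact withSyzygyIn_iterate_mono (hW' _) _ _ (hW _ hX)
      rw [Function.iterate_succ_apply'] at h₁ ⊢
      obtain ⟨K, R, hR, hK, hK'⟩ := h₁
      -- The cover of `F.obj (E X)` composed with the map onto `X` has kernel an extension of `G X`
      -- by `K`, so `m + 1` layers join the `j * (m + 1)` layers of `G X`.
      obtain ⟨Z, hZ, hZ'⟩ := hK.comp (h X)
      refine ⟨Z, R, hR, hZ', ?_⟩
      refine withSyzygyIn_iterate_mono ?_ _ _
        (extensionsOf_withSyzygyIn_iterate _ _ _ _ ⟨K, G X, hK', h₂, hZ⟩)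
      refine (extensionsOf_mono (layers_mono (addObj_le_biprod_left _ _) _)
        (layers_mono (addObj_le_biprod_right _ _) _)).trans ((extensionsOf_layers _ _ _).trans ?_)
      rw [show (j + 1) * (m + 1) = m + 1 + j * (m + 1) by ring]
  obtain ⟨T, W, hW⟩ := key n
  have hpos : 0 < n * (m + 1) := by positivity
  obtain ⟨W', hW'⟩ := hP.exists_layers_le_hasAddResolution W (n * (m + 1) - 1)
  rw [Nat.sub_add_cancel hpos] at hW'
  exact ⟨T, isIgusaTodorovCategory_iff.2
    ⟨W', fun X => withSyzygyIn_iterate_mono hW' T _ (hW X (hG X))⟩⟩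

end IgusaTodorov

/-! ### Exact functors between categories of finitely generated modules -/

section FG

attribute [local instance] Abelian.hasFiniteBiproducts

variable {A : Type u} [Ring A]

theorem shortExact_fgModuleCat_iff [IsNoetherianRing A] (S : ShortComplex (FGModuleCat.{u} A)) :
    S.ShortExact ↔
    Function.Injective S.f.hom.hom ∧ Function.Exact S.f.hom.hom S.g.hom.hom ∧
      Function.Surjective S.g.hom.hom := by
  rw [← ShortExact.shortExact_map_iff (forget₂ (FGModuleCat.{u} A) (ModuleCat.{u} A))]
  constructor
  · exact fun h => ⟨h.moduleCat_injective_f,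
      (ShortComplex.ShortExact.moduleCat_exact_iff_function_exact _).1 h.exact,
      h.moduleCat_surjective_g⟩
  · rintro ⟨h₁, h₂, h₃⟩
    have := (ModuleCat.mono_iff_injective (S.map (forget₂ _ (ModuleCat.{u} A))).f).2 h₁
    have := (ModuleCat.epi_iff_surjective (S.map (forget₂ _ (ModuleCat.{u} A))).g).2 h₃
    exact ⟨(ShortComplex.ShortExact.moduleCat_exact_iff_function_exact _).2 h₂⟩

theorem surjective_of_epi [IsNoetherianRing A] {X Y : FGModuleCat.{u} A} (f : X ⟶ Y) [Epi f] :
    Function.Surjective f.hom.hom :=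
  (ModuleCat.epi_iff_surjective _).1
    (inferInstanceAs (Epi ((forget₂ (FGModuleCat.{u} A) (ModuleCat.{u} A)).map f)))

theorem epi_of_surjective {X Y : FGModuleCat.{u} A} (f : X ⟶ Y)
    (hf : Function.Surjective f.hom.hom) : Epi f := by
  refine ⟨fun g h w => ?_⟩
  ext x
  obtain ⟨x, rfl⟩ := hf x
  exact congrArg (fun k => k.hom.hom x) w

theorem projective_fgModuleCat [IsNoetherianRing A] {X : FGModuleCat.{u} A}
    (h : Module.Projective A X) :
    Projective X where
  factors {E Y} f e _ := by
    obtain ⟨g, hg⟩ := Module.projective_lifting_property e.hom.hom f.hom.hom (surjective_of_epi e)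
    exact ⟨⟨ModuleCat.ofHom g⟩, FGModuleCat.hom_ext hg⟩

theorem isProjectiveGenerator_self (A : Type u) [Ring A] [IsNoetherianRing A] :
    IsProjectiveGenerator (FGModuleCat.of A A) where
  projective := projective_fgModuleCat (inferInstanceAs (Module.Projective A A))
  exists_epi X := by
    obtain ⟨n, f, hf⟩ := Module.Finite.exists_fin' A X
    refine ⟨FGModuleCat.of A (Fin n → A), FGModuleCat.ofHom f, ?_, epi_of_surjective _ hf⟩
    refine addClosure_iff.2 ⟨Fin n, inferInstance, fun _ => FGModuleCat.of A A,
      fun i => FGModuleCat.ofHom (LinearMap.proj i),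
      fun i => FGModuleCat.ofHom (LinearMap.single A (fun _ => A) i),
      fun _ => (ObjectProperty.singleton_iff _ _).2 rfl, ?_⟩
    refine FGModuleCat.hom_ext (LinearMap.ext fun x => ?_)
    let ev : (FGModuleCat.of A (Fin n → A) ⟶ FGModuleCat.of A (Fin n → A)) →+ (Fin n → A) :=
      { toFun := fun f => f.hom.hom x, map_zero' := rfl, map_add' := fun _ _ => rfl }
    refine (map_sum ev _ _).trans ?_
    exact Finset.univ_sum_single x

theorem preserves_of_shortExact {C D : Type*} [Category* C] [Category* D] [Abelian C] [Abelian D]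
    (F : C ⥤ D) [F.Additive] (h : ∀ S : ShortComplex C, S.ShortExact → (S.map F).ShortExact) :
    PreservesFiniteLimits F ∧ PreservesFiniteColimits F :=
  ((Functor.exact_tfae F).out 0 3).1 h

end FG

section Restrict

attribute [local instance] Abelian.hasFiniteBiproducts

variable {A B : Type u} [Ring A] [Ring B]

/-- The abelian group underlying a `B`-module, as an `A`-module via `φ : A →+* B`. -/
def Restrict (_ : A →+* B) (X : Type u) : Type u := X

instance (φ : A →+* B) (X : Type u) [AddCommGroup X] : AddCommGroup (Restrict φ X) :=
  inferInstanceAs (AddCommGroup X)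

instance (φ : A →+* B) (X : Type u) [AddCommGroup X] [Module B X] : Module A (Restrict φ X) :=
  Module.compHom X φ

/-- A `B`-linear map is `A`-linear. -/
def Restrict.map (φ : A →+* B) {X Y : Type u} [AddCommGroup X] [Module B X] [AddCommGroup Y]
    [Module B Y] (f : X →ₗ[B] Y) : Restrict φ X →ₗ[A] Restrict φ Y where
  toFun x := f x
  map_add' := f.map_add
  map_smul' a x := f.map_smul (φ a) x

instance (φ : A →+* B) [Module.Finite A (Restrict φ B)] (X : Type u) [AddCommGroup X] [Module B X]
    [Module.Finite B X] : Module.Finite A (Restrict φ X) := by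
  let _ : Module B (Restrict φ X) := inferInstanceAs (Module B X)
  have : Module.Finite B (Restrict φ X) := inferInstanceAs (Module.Finite B X)
  let _ : Module A B := Module.compHom B φ
  have : Module.Finite A B := inferInstanceAs (Module.Finite A (Restrict φ B))
  have : IsScalarTower A B (Restrict φ X) := ⟨fun a b x => mul_smul (φ a) b (show X from x)⟩
  exact Module.Finite.trans B _

theorem finite_restrict_of_surjective {φ : A →+* B} (h : Function.Surjective φ) :
    Module.Finite A (Restrict φ B) :=
  Module.Finite.of_surjective
    ({ toFun := φ, map_add' := map_add φ, map_smul' := fun a b => map_mul φ a b } :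
      A →ₗ[A] Restrict φ B) h

/-- The restriction of scalars of finitely generated modules along a finite ring homomorphism. -/
def restrictFG (φ : A →+* B) [Module.Finite A (Restrict φ B)] :
    FGModuleCat.{u} B ⥤ FGModuleCat.{u} A where
  obj X := FGModuleCat.of A (Restrict φ X)
  map f := FGModuleCat.ofHom (Restrict.map φ f.hom.hom)

instance (φ : A →+* B) [Module.Finite A (Restrict φ B)] : (restrictFG φ).Additive where
  map_add := rfl

/-- The composition of two restrictions of scalars is the identity if the scalars act in the same
way. -/
def restrictFGCompIso (φ : A →+* B) (ψ : B →+* A) [Module.Finite A (Restrict φ B)]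
    [Module.Finite B (Restrict ψ A)] (h : ∀ a, ψ (φ a) = a) :
    restrictFG ψ ⋙ restrictFG φ ≅ 𝟭 (FGModuleCat.{u} A) :=
  NatIso.ofComponents (fun X => LinearEquiv.toFGModuleCatIso
    ({ toFun := fun x => x
       invFun := fun x => x
       map_add' := fun _ _ => rfl
       map_smul' := fun a x => congrArg (fun b => b • (show X from x)) (h a)
       left_inv := fun _ => rfl
       right_inv := fun _ => rfl } : Restrict φ (Restrict ψ X) ≃ₗ[A] X)) (fun _ => rfl)

/-! ### The two-step filtration of a module by a square-zero ideal -/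

/-- The elements of `X` that are killed by the kernel of `π`. -/
def killedByKer (π : B →+* A) (X : Type u) [AddCommGroup X] [Module B X] : Submodule B X where
  carrier := {x | ∀ b, π b = 0 → b • x = 0}
  add_mem' hx hy b hb := by rw [smul_add, hx b hb, hy b hb, add_zero]
  zero_mem' b _ := smul_zero b
  smul_mem' c x hx b hb := by rw [← mul_smul, hx _ (by rw [map_mul, hb, zero_mul])]

theorem killedByKer_le_comap (π : B →+* A) {X Y : Type u} [AddCommGroup X] [Module B X]
    [AddCommGroup Y] [Module B Y] (f : X →ₗ[B] Y) :
    killedByKer π X ≤ (killedByKer π Y).comap f := fun x hx b hb => by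
  rw [← map_smul, hx b hb, map_zero]

/-- The difference `b - ι (π b)` lies in the kernel of `π`. Hence restricting such a module along
`ι` and then along `π` recovers its original structure. -/
theorem smul_eq_of_killed {ι : A →+* B} {π : B →+* A} (hπ : ∀ a, π (ι a) = a) {X : Type u}
    [AddCommGroup X] [Module B X] (hX : ∀ (x : X) (b : B), π b = 0 → b • x = 0) (b : B) (x : X) :
    ι (π b) • x = b • x := by
  rw [← sub_eq_zero, ← sub_smul]
  exact hX x _ (by rw [map_sub, hπ, sub_self])

variable [IsNoetherianRing B]

theorem shortExact_restrictFG [IsNoetherianRing A] (φ : A →+* B) [Module.Finite A (Restrict φ B)]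
    (S : ShortComplex (FGModuleCat.{u} B)) (hS : S.ShortExact) :
    (S.map (restrictFG φ)).ShortExact := by
  rw [shortExact_fgModuleCat_iff] at hS ⊢
  exact hS

instance [IsNoetherianRing A] (φ : A →+* B) [Module.Finite A (Restrict φ B)] :
    PreservesFiniteLimits (restrictFG φ) :=
  (preserves_of_shortExact _ (shortExact_restrictFG φ)).1

instance [IsNoetherianRing A] (φ : A →+* B) [Module.Finite A (Restrict φ B)] :
    PreservesFiniteColimits (restrictFG φ) :=
  (preserves_of_shortExact _ (shortExact_restrictFG φ)).2

/-- Every projective is a summand of a finite power of `B`, so it suffices to test `B` itself. -/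
theorem preservesProjectiveObjects_restrictFG [IsNoetherianRing A] (φ : A →+* B)
    [Module.Finite A (Restrict φ B)] (h : Module.Projective A (Restrict φ B)) :
    (restrictFG φ).PreservesProjectiveObjects where
  projective_obj {P} hP := by
    have hB : Projective ((restrictFG φ).obj (FGModuleCat.of B B)) := projective_fgModuleCat h
    exact projective_of_addObj (addObj_map (restrictFG φ)
      ((isProjectiveGenerator_self B).addObj_of_projective P))

/-- The subobject of elements killed by the kernel of `π`, as a functor. -/
def killedFunctor (π : B →+* A) : FGModuleCat.{u} B ⥤ FGModuleCat.{u} B where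
  obj X := FGModuleCat.of B (killedByKer π X)
  map f := FGModuleCat.ofHom (f.hom.hom.restrict (killedByKer_le_comap π f.hom.hom))

instance (π : B →+* A) : (killedFunctor π).Additive where
  map_add := rfl

/-- The quotient by the elements killed by the kernel of `π`, as a functor. -/
def killedQuotientFunctor (π : B →+* A) : FGModuleCat.{u} B ⥤ FGModuleCat.{u} B where
  obj X := FGModuleCat.of B (X ⧸ killedByKer π X)
  map f := FGModuleCat.ofHom
    ((killedByKer π _).mapQ (killedByKer π _) f.hom.hom (killedByKer_le_comap π f.hom.hom))
  map_id X := by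
    ext x
    rfl
  map_comp f g := by
    ext x
    rfl

instance (π : B →+* A) : (killedQuotientFunctor π).Additive where
  map_add {X Y f g} := by
    refine FGModuleCat.hom_ext (LinearMap.ext fun x => ?_)
    obtain ⟨x, rfl⟩ := Submodule.mkQ_surjective (killedByKer π X) x
    rfl

variable (ι : A →+* B) (π : B →+* A) [Module.Finite A (Restrict ι B)]
  [Module.Finite B (Restrict π A)]

/-- The inclusion of the elements killed by the kernel of `π`. -/
def killedInclusion (hπ : ∀ a, π (ι a) = a) :
    (killedFunctor π ⋙ restrictFG ι) ⋙ restrictFG π ⟶ 𝟭 (FGModuleCat.{u} B) where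
  app X := FGModuleCat.ofHom
    ({ toFun := fun x => (show killedByKer π X from x).1
       map_add' := fun _ _ => rfl
       map_smul' := fun b x => congrArg Subtype.val
        (smul_eq_of_killed hπ (X := killedByKer π X)
          (fun x b hb => Subtype.ext (x.2 b hb)) b x) } :
      Restrict π (Restrict ι (killedByKer π X)) →ₗ[B] X)

/-- The projection to the quotient by the elements killed by the kernel of `π`. -/
def killedProjection (hπ : ∀ a, π (ι a) = a) (h : ∀ a b, π a = 0 → π b = 0 → a * b = 0) :
    𝟭 (FGModuleCat.{u} B) ⟶ (killedQuotientFunctor π ⋙ restrictFG ι) ⋙ restrictFG π where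
  app X := FGModuleCat.ofHom
    ({ toFun := fun x => (killedByKer π X).mkQ x
       map_add' := fun _ _ => rfl
       map_smul' := fun b x => (smul_eq_of_killed hπ (X := X ⧸ killedByKer π X) (by
          intro x b hb
          obtain ⟨x, rfl⟩ := Submodule.mkQ_surjective _ x
          rw [← map_smul]
          -- The kernel of `π` maps `X` into the killed elements because products of two elements of
          -- the kernel vanish, so it acts as zero on the quotient.
          refine (Submodule.Quotient.mk_eq_zero _).2 fun c hc => ?_
          rw [← mul_smul, h c b hc hb, zero_smul]) b ((killedByKer π X).mkQ x)).symm } :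
      X →ₗ[B] Restrict π (Restrict ι (X ⧸ killedByKer π X)))

theorem killed_comp_eq_zero (hπ : ∀ a, π (ι a) = a)
    (h : ∀ a b, π a = 0 → π b = 0 → a * b = 0) (X : FGModuleCat.{u} B) :
    (killedInclusion ι π hπ).app X ≫ (killedProjection ι π hπ h).app X = 0 := by
  ext x
  exact (Submodule.Quotient.mk_eq_zero _).2 (show killedByKer π X from x).2

theorem killed_shortExact (hπ : ∀ a, π (ι a) = a)
    (h : ∀ a b, π a = 0 → π b = 0 → a * b = 0) (X : FGModuleCat.{u} B) :
    (ShortComplex.mk _ _ (killed_comp_eq_zero ι π hπ h X)).ShortExact := by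
  rw [shortExact_fgModuleCat_iff]
  refine ⟨fun x y hxy => Subtype.ext hxy, fun x => ⟨fun hx => ?_, ?_⟩,
    Submodule.mkQ_surjective (killedByKer π X)⟩
  · exact ⟨⟨x, (Submodule.Quotient.mk_eq_zero (killedByKer π X)).1 hx⟩, rfl⟩
  · rintro ⟨y, rfl⟩
    exact (Submodule.Quotient.mk_eq_zero (killedByKer π X)).2 (show killedByKer π X from y).2

end Restrict

/-! ### Induction of modules to the trivial extension -/

section Induction

open MulOpposite

variable {Γ : Type u} [Ring Γ]

theorem NCTensor.addSubgroup_eq_top {X Y : Type u} [AddCommGroup X] [Module Γᵐᵒᵖ X]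
    [AddCommGroup Y] [Module Γ Y] (S : AddSubgroup (NCTensor Γ X Y))
    (h : ∀ x y, NCTensor.tmul x y ∈ S) : S = ⊤ := by
  have : QuotientAddGroup.mk' S = 0 := NCTensor.hom_ext fun x y =>
    (QuotientAddGroup.eq_zero_iff _).2 (h x y)
  exact top_unique fun z _ => (QuotientAddGroup.eq_zero_iff z).1 (DFunLike.congr_fun this z)

theorem NCTensor.tmul_zero {X Y : Type u} [AddCommGroup X] [Module Γᵐᵒᵖ X]
    [AddCommGroup Y] [Module Γ Y] (x : X) : (NCTensor.tmul x (0 : Y) : NCTensor Γ X Y) = 0 := by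
  simpa using NCTensor.tmul_add (Γ := Γ) x (0 : Y) 0

theorem NCTensor.zero_tmul {X Y : Type u} [AddCommGroup X] [Module Γᵐᵒᵖ X]
    [AddCommGroup Y] [Module Γ Y] (y : Y) : (NCTensor.tmul (0 : X) y : NCTensor Γ X Y) = 0 := by
  simpa using NCTensor.add_tmul (Γ := Γ) (0 : X) 0 y

/-- The universal property of the tensor product over a noncommutative ring. -/
def NCTensor.lift {X Y A : Type u} [AddCommGroup X] [Module Γᵐᵒᵖ X]
    [AddCommGroup Y] [Module Γ Y] [AddCommGroup A] (f : X →+ Y →+ A)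
    (hf : ∀ (x : X) (γ : Γ) (y : Y), f (op γ • x) y = f x (γ • y)) : NCTensor Γ X Y →+ A :=
  QuotientAddGroup.lift _ (TensorProduct.liftAddHom f fun n x y => by simp) (by
    refine (AddSubgroup.closure_le _).2 ?_
    rintro _ ⟨x, γ, y, rfl⟩
    simp [hf])

variable {M : Type u} [AddCommGroup M] [Module Γ M] [Module Γᵐᵒᵖ M] [SMulCommClass Γ Γᵐᵒᵖ M]

attribute [local instance] NCTensor.rightModule

theorem NCTensor.op_smul_tmul {X : Type u} [AddCommGroup X] [Module Γᵐᵒᵖ X] (γ : Γᵐᵒᵖ) (x : X)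
    (m : M) : γ • (NCTensor.tmul x m : NCTensor Γ X M) = NCTensor.tmul x (γ • m) := rfl

/-- A map of right modules `X → X'` induces a map of right modules `X ⊗ M → X' ⊗ M`. -/
noncomputable def NCTensor.mapLeft (M : Type u) [AddCommGroup M] [Module Γ M] [Module Γᵐᵒᵖ M]
    [SMulCommClass Γ Γᵐᵒᵖ M] {X X' : Type u} [AddCommGroup X] [Module Γᵐᵒᵖ X]
    [AddCommGroup X'] [Module Γᵐᵒᵖ X'] (f : X →ₗ[Γᵐᵒᵖ] X') :
    NCTensor Γ X M →ₗ[Γᵐᵒᵖ] NCTensor Γ X' M where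
  toFun := NCTensor.map f LinearMap.id
  map_add' := map_add _
  map_smul' γ z := by
    have : (NCTensor.map f LinearMap.id).comp (rightAction γ : AddMonoid.End (NCTensor Γ X M)) =
        (rightAction γ : AddMonoid.End (NCTensor Γ X' M)).comp (NCTensor.map f LinearMap.id) :=
      NCTensor.hom_ext fun x y => rfl
    exact DFunLike.congr_fun this z

theorem NCTensor.mapLeft_tmul {X X' : Type u} [AddCommGroup X] [Module Γᵐᵒᵖ X]
    [AddCommGroup X'] [Module Γᵐᵒᵖ X'] (f : X →ₗ[Γᵐᵒᵖ] X') (x : X) (m : M) :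
    NCTensor.mapLeft M f (NCTensor.tmul x m) = NCTensor.tmul (f x) m := rfl

/-- The inclusion of `Γ` in its trivial extension, on the opposite rings. -/
def inlOp (Γ M : Type u) [Ring Γ] [AddCommGroup M] [Module Γ M] [Module Γᵐᵒᵖ M]
    [SMulCommClass Γ Γᵐᵒᵖ M] : Γᵐᵒᵖ →+* (TrivSqZeroExt Γ M)ᵐᵒᵖ :=
  RingHom.op (TrivSqZeroExt.inlHom Γ M)

/-- The projection of the trivial extension to `Γ`, on the opposite rings. -/
def fstOp (Γ M : Type u) [Ring Γ] [AddCommGroup M] [Module Γ M] [Module Γᵐᵒᵖ M]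
    [SMulCommClass Γ Γᵐᵒᵖ M] : (TrivSqZeroExt Γ M)ᵐᵒᵖ →+* Γᵐᵒᵖ :=
  RingHom.op
    { toFun := TrivSqZeroExt.fst
      map_one' := rfl
      map_mul' := fun _ _ => rfl
      map_zero' := rfl
      map_add' := fun _ _ => rfl }

theorem fstOp_inlOp (γ : Γᵐᵒᵖ) : fstOp Γ M (inlOp Γ M γ) = γ := rfl

theorem mul_eq_zero_of_fstOp (a b : (TrivSqZeroExt Γ M)ᵐᵒᵖ) (ha : fstOp Γ M a = 0)
    (hb : fstOp Γ M b = 0) : a * b = 0 := by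
  have ha' : a.unop.fst = 0 := op_injective ha
  have hb' : b.unop.fst = 0 := op_injective hb
  refine unop_injective (TrivSqZeroExt.ext ?_ ?_)
  · simp [ha']
  · simp [ha', hb']

/-- The right module `Y ⊗_Γ (Γ ⋉ M) = Y ⊕ (Y ⊗_Γ M)` over the trivial extension `Γ ⋉ M`. -/
def Induced (Γ : Type u) [Ring Γ] (M : Type u) [AddCommGroup M] [Module Γ M] (Y : Type u)
    [AddCommGroup Y] [Module Γᵐᵒᵖ Y] : Type u :=
  Y × NCTensor Γ Y M

section

variable {Y : Type u} [AddCommGroup Y] [Module Γᵐᵒᵖ Y]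

instance : AddCommGroup (Induced Γ M Y) := inferInstanceAs (AddCommGroup (Y × NCTensor Γ Y M))

/-- The action is `(y, z)(γ, m) = (yγ, zγ + y ⊗ m)`; associativity rests on the balancing relation
`yγ ⊗ m = y ⊗ γm`. -/
noncomputable instance : Module (TrivSqZeroExt Γ M)ᵐᵒᵖ (Induced Γ M Y) where
  smul a p := ((op a.unop.fst • p.1, op a.unop.fst • p.2 + NCTensor.tmul p.1 a.unop.snd) :
    Y × NCTensor Γ Y M)
  one_smul p := Prod.ext (one_smul _ p.1) (by
    change (1 : Γᵐᵒᵖ) • p.2 + NCTensor.tmul p.1 (0 : M) = p.2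
    rw [one_smul, NCTensor.tmul_zero, add_zero])
  mul_smul a b p := Prod.ext (mul_smul (op a.unop.fst) (op b.unop.fst) p.1) (by
    change (op a.unop.fst * op b.unop.fst) • p.2 +
      NCTensor.tmul p.1 (b.unop.fst • a.unop.snd + op a.unop.fst • b.unop.snd) =
      op a.unop.fst • (op b.unop.fst • p.2 + NCTensor.tmul p.1 b.unop.snd) +
        NCTensor.tmul (op b.unop.fst • p.1) a.unop.snd
    rw [mul_smul, NCTensor.tmul_add, smul_add, NCTensor.op_smul_tmul, NCTensor.smul_tmul]
    abel)
  smul_zero a := Prod.ext (smul_zero _) (by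
    change op a.unop.fst • (0 : NCTensor Γ Y M) + NCTensor.tmul 0 a.unop.snd = 0
    rw [smul_zero, NCTensor.zero_tmul, add_zero])
  smul_add a p q := Prod.ext (smul_add _ _ _) (by
    change op a.unop.fst • (p.2 + q.2) + NCTensor.tmul (p.1 + q.1) a.unop.snd =
      op a.unop.fst • p.2 + NCTensor.tmul p.1 a.unop.snd +
        (op a.unop.fst • q.2 + NCTensor.tmul q.1 a.unop.snd)
    rw [smul_add, NCTensor.add_tmul]
    abel)
  add_smul a b p := Prod.ext (add_smul (op a.unop.fst) (op b.unop.fst) p.1) (by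
    change (op a.unop.fst + op b.unop.fst) • p.2 +
      NCTensor.tmul p.1 (a.unop.snd + b.unop.snd) =
      op a.unop.fst • p.2 + NCTensor.tmul p.1 a.unop.snd +
        (op b.unop.fst • p.2 + NCTensor.tmul p.1 b.unop.snd)
    rw [add_smul, NCTensor.tmul_add]
    abel)
  zero_smul p := Prod.ext (zero_smul _ _) (by
    change (0 : Γᵐᵒᵖ) • p.2 + NCTensor.tmul p.1 (0 : M) = 0
    rw [zero_smul, NCTensor.tmul_zero, add_zero])

/-- The right multiplication `X ⊗_Γ M → X` on a right module `X` over the trivial extension. -/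
noncomputable def mulM (X : Type u) [AddCommGroup X] [Module (TrivSqZeroExt Γ M)ᵐᵒᵖ X] :
    NCTensor Γ (Restrict (inlOp Γ M) X) M →+ X :=
  NCTensor.lift
    { toFun := fun x =>
        { toFun := fun m => op (TrivSqZeroExt.inr m : TrivSqZeroExt Γ M) • (show X from x)
          map_zero' := zero_smul (TrivSqZeroExt Γ M)ᵐᵒᵖ (show X from x)
          map_add' := fun m m' => by
            rw [TrivSqZeroExt.inr_add, MulOpposite.op_add]
            exact add_smul _ _ (show X from x) }
      map_zero' := AddMonoidHom.ext fun m => smul_zero (A := X) _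
      map_add' := fun x y => AddMonoidHom.ext fun m => smul_add _ (show X from x) (show X from y) }
    (fun x γ m => by
      change op (TrivSqZeroExt.inr m : TrivSqZeroExt Γ M) •
        (op (TrivSqZeroExt.inl γ : TrivSqZeroExt Γ M)) • (show X from x) =
          op (TrivSqZeroExt.inr (γ • m) : TrivSqZeroExt Γ M) • (show X from x)
      rw [← mul_smul, ← op_mul, TrivSqZeroExt.inl_mul_inr])

theorem mulM_tmul {X : Type u} [AddCommGroup X] [Module (TrivSqZeroExt Γ M)ᵐᵒᵖ X]
    (x : Restrict (inlOp Γ M) X) (m : M) : mulM X (NCTensor.tmul x m) =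
      op (TrivSqZeroExt.inr m : TrivSqZeroExt Γ M) • (show X from x) := rfl

/-- Since `M` squares to zero, only the `Γ`-component of `a` acts on elements of `XM`. -/
theorem smul_mulM {X : Type u} [AddCommGroup X] [Module (TrivSqZeroExt Γ M)ᵐᵒᵖ X]
    (a : (TrivSqZeroExt Γ M)ᵐᵒᵖ) (z : NCTensor Γ (Restrict (inlOp Γ M) X) M) :
    a • mulM X z = mulM X (op a.unop.fst • z) := by
  have : (DistribSMul.toAddMonoidHom X a).comp (mulM X) =
      (mulM X).comp (DistribSMul.toAddMonoidHom (NCTensor Γ (Restrict (inlOp Γ M) X) M)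
        (op a.unop.fst)) := by
    refine NCTensor.hom_ext fun x m => ?_
    change a • op (TrivSqZeroExt.inr m : TrivSqZeroExt Γ M) • (show X from x) =
      op (TrivSqZeroExt.inr (op a.unop.fst • m) : TrivSqZeroExt Γ M) • (show X from x)
    rw [← mul_smul]
    congr 1
    refine unop_injective (TrivSqZeroExt.ext ?_ ?_) <;> simp
  exact DFunLike.congr_fun this z

/-- The extension of a map of right `Γ`-modules to the induced module. -/
noncomputable def Induced.extend {X : Type u} [AddCommGroup X] [Module (TrivSqZeroExt Γ M)ᵐᵒᵖ X]
    (g : Y →ₗ[Γᵐᵒᵖ] Restrict (inlOp Γ M) X) :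
    Induced Γ M Y →ₗ[(TrivSqZeroExt Γ M)ᵐᵒᵖ] X where
  toFun p := (show X from g p.1) + mulM X (NCTensor.mapLeft M g p.2)
  map_add' p q := by
    change (show X from g (p.1 + q.1)) + mulM X (NCTensor.mapLeft M g (p.2 + q.2)) = _
    rw [map_add, map_add, map_add]
    exact add_add_add_comm _ _ _ _
  map_smul' a p := by
    change (show X from g (op a.unop.fst • p.1)) + mulM X (NCTensor.mapLeft M g
      (op a.unop.fst • p.2 + NCTensor.tmul p.1 a.unop.snd)) = a • (_ + _)
    rw [map_smul, map_add, map_add, map_smul, smul_add, smul_mulM, NCTensor.mapLeft_tmul, mulM_tmul]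
    have : a = inlOp Γ M (op a.unop.fst) + op (TrivSqZeroExt.inr a.unop.snd) :=
      unop_injective (TrivSqZeroExt.inl_fst_add_inr_snd_eq _).symm
    have h : a • (show X from g p.1) = (show X from op a.unop.fst • g p.1) +
        op (TrivSqZeroExt.inr a.unop.snd : TrivSqZeroExt Γ M) • (show X from g p.1) := by
      conv_lhs => rw [this, add_smul]
      rfl
    refine Eq.trans ?_ (congrArg (· + _) h.symm)
    exact (add_assoc _ _ _).symm.trans (add_right_comm _ _ _)

/-- The inclusion of `Y` in the module induced from it. -/
def Induced.of (Γ : Type u) [Ring Γ] (M : Type u) [AddCommGroup M] [Module Γ M]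
    {Y : Type u} [AddCommGroup Y] [Module Γᵐᵒᵖ Y] (y : Y) : Induced Γ M Y :=
  ((y, 0) : Y × NCTensor Γ Y M)

theorem Induced.ext {M : Type u} [AddCommGroup M] [Module Γ M] {p q : Induced Γ M Y}
    (h₁ : p.1 = q.1) (h₂ : p.2 = q.2) : p = q :=
  Prod.ext h₁ h₂

theorem Induced.of_add {M : Type u} [AddCommGroup M] [Module Γ M] (y y' : Y) :
    of Γ M (y + y') = of Γ M y + of Γ M y' :=
  Induced.ext rfl (add_zero (0 : NCTensor Γ Y M)).symm

theorem Induced.of_smul (c : Γᵐᵒᵖ) (y : Y) : of Γ M (c • y) = inlOp Γ M c • of Γ M y := by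
  refine Induced.ext rfl ?_
  change (0 : NCTensor Γ Y M) = c • (0 : NCTensor Γ Y M) + NCTensor.tmul y (0 : M)
  rw [smul_zero, NCTensor.tmul_zero, add_zero]

theorem Induced.extend_of {X : Type u} [AddCommGroup X] [Module (TrivSqZeroExt Γ M)ᵐᵒᵖ X]
    (g : Y →ₗ[Γᵐᵒᵖ] Restrict (inlOp Γ M) X) (y : Y) :
    Induced.extend g (of Γ M y) = (show X from g y) := by
  refine (congrArg (fun x => (show X from g y) + mulM X x)
    (map_zero (NCTensor.mapLeft M g))).trans ?_
  rw [map_zero, add_zero]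

/-- The copy of `Y` generates the induced module, because `y ⊗ m` is the product of `(y, 0)` with
`m`. -/
theorem Induced.hom_ext {X : Type u} [AddCommGroup X] [Module (TrivSqZeroExt Γ M)ᵐᵒᵖ X]
    {f g : Induced Γ M Y →ₗ[(TrivSqZeroExt Γ M)ᵐᵒᵖ] X}
    (h : ∀ y : Y, f (of Γ M y) = g (of Γ M y)) : f = g := by
  let i : NCTensor Γ Y M →+ Induced Γ M Y := AddMonoidHom.inr Y (NCTensor Γ Y M)
  have h' : f.toAddMonoidHom.comp i = g.toAddMonoidHom.comp i := by
    refine NCTensor.hom_ext fun y m => ?_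
    have e : i (NCTensor.tmul y m) = op (TrivSqZeroExt.inr m : TrivSqZeroExt Γ M) • of Γ M y := by
      refine Induced.ext (zero_smul Γᵐᵒᵖ y).symm ?_
      change NCTensor.tmul y m = (0 : Γᵐᵒᵖ) • (0 : NCTensor Γ Y M) + NCTensor.tmul y m
      rw [zero_smul, zero_add]
    change f (i _) = g (i _)
    rw [e, map_smul, map_smul, h]
  refine LinearMap.ext fun p => ?_
  have e : p = of Γ M p.1 + i p.2 :=
    Induced.ext (add_zero p.1).symm (zero_add p.2).symm
  rw [e, map_add, map_add, h]
  exact congrArg _ (DFunLike.congr_fun h' p.2)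

/-- The functoriality of the induced module. -/
noncomputable def Induced.map {Y' : Type u} [AddCommGroup Y'] [Module Γᵐᵒᵖ Y']
    (f : Y →ₗ[Γᵐᵒᵖ] Y') : Induced Γ M Y →ₗ[(TrivSqZeroExt Γ M)ᵐᵒᵖ] Induced Γ M Y' where
  toFun p := ((f p.1, NCTensor.mapLeft M f p.2) : Y' × NCTensor Γ Y' M)
  map_add' p q := Prod.ext (map_add f _ _) (map_add (NCTensor.mapLeft M f) _ _)
  map_smul' a p := Prod.ext (map_smul f _ _) (by
    change NCTensor.mapLeft M f (op a.unop.fst • p.2 + NCTensor.tmul p.1 a.unop.snd) =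
      op a.unop.fst • NCTensor.mapLeft M f p.2 + NCTensor.tmul (f p.1) a.unop.snd
    rw [map_add, map_smul, NCTensor.mapLeft_tmul])

theorem span_induced_eq_top (M : Type u) [AddCommGroup M] [Module Γ M] [Module Γᵐᵒᵖ M]
    [SMulCommClass Γ Γᵐᵒᵖ M] {s : Set Y} (hs : Submodule.span Γᵐᵒᵖ s = ⊤) :
    Submodule.span (TrivSqZeroExt Γ M)ᵐᵒᵖ (Induced.of Γ M '' s) = ⊤ := by
  set N := Submodule.span (TrivSqZeroExt Γ M)ᵐᵒᵖ (Induced.of Γ M '' s) with hN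
  have hf : N.mkQ = 0 := Induced.hom_ext fun y => by
    let T : Submodule Γᵐᵒᵖ Y :=
      { carrier := {y | Induced.of Γ M y ∈ N}
        add_mem' := fun {a b} ha hb => by
          rw [Set.mem_ofPred_eq, Induced.of_add]
          exact N.add_mem ha hb
        zero_mem' := N.zero_mem
        smul_mem' := fun c y hy => by
          rw [Set.mem_ofPred_eq, Induced.of_smul]
          exact N.smul_mem _ hy }
    have hT : T = ⊤ := top_unique (hs ▸ Submodule.span_le.2 fun y hy =>
      Submodule.subset_span ⟨y, hy, rfl⟩)
    have hy : y ∈ T := hT ▸ Submodule.mem_top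
    exact (Submodule.Quotient.mk_eq_zero N).2 hy
  exact top_unique fun p _ => (Submodule.Quotient.mk_eq_zero N).1 (LinearMap.congr_fun hf p)

instance [Module.Finite Γᵐᵒᵖ Y] : Module.Finite (TrivSqZeroExt Γ M)ᵐᵒᵖ (Induced Γ M Y) := by
  obtain ⟨s, hs⟩ := (Module.Finite.fg_top : (⊤ : Submodule Γᵐᵒᵖ Y).FG)
  classical
  exact ⟨s.image (Induced.of Γ M), by rw [Finset.coe_image]; exact span_induced_eq_top M hs⟩

end

/-- Induction of finitely generated right modules to the trivial extension. -/
noncomputable def inducedFG (Γ : Type u) [Ring Γ] (M : Type u) [AddCommGroup M] [Module Γ M]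
    [Module Γᵐᵒᵖ M] [SMulCommClass Γ Γᵐᵒᵖ M] :
    FGModuleCat.{u} Γᵐᵒᵖ ⥤ FGModuleCat.{u} (TrivSqZeroExt Γ M)ᵐᵒᵖ where
  obj Y := FGModuleCat.of _ (Induced Γ M Y)
  map f := FGModuleCat.ofHom (Induced.map f.hom.hom)
  map_id Y := FGModuleCat.hom_ext (Induced.hom_ext fun y => Prod.ext rfl (map_zero _))
  map_comp f g := FGModuleCat.hom_ext (Induced.hom_ext fun y => Prod.ext rfl (by
    change NCTensor.mapLeft M _ 0 = NCTensor.mapLeft M _ (NCTensor.mapLeft M _ 0)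
    simp only [map_zero]))

instance : (inducedFG Γ M).Additive where
  map_add {X Y f g} := FGModuleCat.hom_ext (Induced.hom_ext fun y => Prod.ext rfl (by
    change NCTensor.mapLeft M _ 0 = NCTensor.mapLeft M _ 0 + NCTensor.mapLeft M _ 0
    simp only [map_zero, add_zero]))

/-! ### Exactness of induction. -/

section Exact

variable [Module.Finite Γ M] [Module.Projective Γ M]

/-- If `M` is finitely generated and projective as a left module, then `X ⊗_Γ M` is a natural
direct summand of a finite power of `X`. -/
theorem exists_natural_retract (M : Type u) [AddCommGroup M] [Module Γ M] [Module.Finite Γ M]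
    [Module.Projective Γ M] : ∃ (k : ℕ)
    (a : ∀ (X : Type u) [AddCommGroup X] [Module Γᵐᵒᵖ X], NCTensor Γ X M →+ (Fin k → X))
    (b : ∀ (X : Type u) [AddCommGroup X] [Module Γᵐᵒᵖ X], (Fin k → X) →+ NCTensor Γ X M),
    (∀ (X : Type u) [AddCommGroup X] [Module Γᵐᵒᵖ X] (z : NCTensor Γ X M), b X (a X z) = z) ∧
    (∀ (X Y : Type u) [AddCommGroup X] [Module Γᵐᵒᵖ X] [AddCommGroup Y] [Module Γᵐᵒᵖ Y]
      (f : X →ₗ[Γᵐᵒᵖ] Y) (z : NCTensor Γ X M),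
        a Y (NCTensor.map f LinearMap.id z) = fun i => f (a X z i)) ∧
    (∀ (X Y : Type u) [AddCommGroup X] [Module Γᵐᵒᵖ X] [AddCommGroup Y] [Module Γᵐᵒᵖ Y]
      (f : X →ₗ[Γᵐᵒᵖ] Y) (w : Fin k → X),
        b Y (fun i => f (w i)) = NCTensor.map f LinearMap.id (b X w)) := by
  obtain ⟨k, p, s, -, -, hps⟩ := Module.Finite.exists_comp_eq_id_of_projective Γ M
  -- The maps `s` and `p` exhibit `M` as a summand of `Γ^k`. Tensoring with `X` sends `x ⊗ m` to the
  -- tuple `x · s(m)_i`, and a tuple `w` back to the sum of the `w_i ⊗ p(e_i)`.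
  let a (X : Type u) [AddCommGroup X] [Module Γᵐᵒᵖ X] : NCTensor Γ X M →+ (Fin k → X) :=
    NCTensor.lift
    { toFun := fun x =>
        { toFun := fun m i => op (s m i) • x
          map_zero' := by ext; simp
          map_add' := fun m m' => by ext; simp [add_smul] }
      map_zero' := by ext; simp
      map_add' := fun x y => by ext; simp }
    (fun x γ m => by ext i; simp [mul_smul])
  let b (X : Type u) [AddCommGroup X] [Module Γᵐᵒᵖ X] : (Fin k → X) →+ NCTensor Γ X M :=
    { toFun := fun w => ∑ i, NCTensor.tmul (w i) (p (Pi.single i 1))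
      map_zero' := by simp [NCTensor.zero_tmul]
      map_add' := fun v w => by simp [NCTensor.add_tmul, Finset.sum_add_distrib] }
  refine ⟨k, a, b, ?_, ?_, ?_⟩
  · intro X _ _ z
    refine DFunLike.congr_fun (f := (b X).comp (a X)) (g := AddMonoidHom.id (NCTensor Γ X M))
      (NCTensor.hom_ext fun x m => ?_) z
    change ∑ i, NCTensor.tmul (op (s m i) • x) (p (Pi.single i 1)) = NCTensor.tmul x m
    have h : ∀ i, (NCTensor.tmul (op (s m i) • x) (p (Pi.single i 1)) : NCTensor Γ X M) =
        NCTensor.tmul x (p (Pi.single i (s m i))) := fun i => by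
      rw [NCTensor.smul_tmul, ← map_smul, ← Pi.single_smul, smul_eq_mul, mul_one]
    let τ : M →+ NCTensor Γ X M :=
      { toFun := NCTensor.tmul x
        map_zero' := NCTensor.tmul_zero x
        map_add' := NCTensor.tmul_add x }
    have h' := map_sum τ (fun i => p (Pi.single i (s m i))) Finset.univ
    rw [← map_sum, Finset.univ_sum_single] at h'
    rw [Finset.sum_congr rfl fun i _ => h i]
    exact h'.symm.trans (congrArg τ (LinearMap.congr_fun hps m))
  · intro X Y _ _ _ _ f z
    refine DFunLike.congr_fun (f := (a Y).comp (NCTensor.map f LinearMap.id))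
      (g := (AddMonoidHom.pi fun i => f.toAddMonoidHom.comp
        (Pi.evalAddMonoidHom (fun _ : Fin k => X) i)).comp (a X))
      (NCTensor.hom_ext fun x m => ?_) z
    funext i
    exact (map_smul f (op (s m i)) x).symm
  · intro X Y _ _ _ _ f w
    change ∑ i, NCTensor.tmul (f (w i)) _ =
      NCTensor.map f LinearMap.id (∑ i, NCTensor.tmul (w i) (p (Pi.single i 1)))
    refine Eq.trans ?_ (map_sum (NCTensor.map f (LinearMap.id (R := Γ) (M := M)))
      (fun i => NCTensor.tmul (w i) (p (Pi.single i 1))) Finset.univ).symm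
    rfl

/-- The component in `X ⊗_Γ M` is a natural retract of a finite power of `X`, so injectivity,
exactness and surjectivity are checked coordinatewise and transported back by naturality. -/
theorem shortExact_inducedFG [IsNoetherianRing Γᵐᵒᵖ] [IsNoetherianRing (TrivSqZeroExt Γ M)ᵐᵒᵖ]
    (S : ShortComplex (FGModuleCat.{u} Γᵐᵒᵖ)) (hS : S.ShortExact) :
    (S.map (inducedFG Γ M)).ShortExact := by
  rw [shortExact_fgModuleCat_iff] at hS ⊢
  obtain ⟨h₁, h₂, h₃⟩ := hS
  obtain ⟨k, a, b, hab, ha, hb⟩ := exists_natural_retract (Γ := Γ) M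
  refine ⟨fun p q h => Prod.ext (h₁ (congrArg Prod.fst h)) ?_, fun p => ⟨fun hp => ?_, ?_⟩,
    fun p => ?_⟩
  · have h' : NCTensor.map S.f.hom.hom LinearMap.id p.2 =
      NCTensor.map S.f.hom.hom LinearMap.id q.2 := congrArg Prod.snd h
    rw [← hab _ p.2, ← hab _ q.2]
    refine congrArg _ (funext fun i => h₁ ?_)
    have := congrArg (a _) h'
    rw [ha, ha] at this
    exact congrFun this i
  · have h' : NCTensor.map S.g.hom.hom LinearMap.id p.2 = 0 := congrArg Prod.snd hp
    obtain ⟨y, hy⟩ := (h₂ p.1).1 (congrArg Prod.fst hp)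
    have h'' : ∀ i, ∃ w, S.f.hom.hom w = a _ p.2 i := fun i => (h₂ _).1 (by
      have := congrArg (a _) h'
      rw [ha, map_zero] at this
      exact congrFun this i)
    choose w hw using h''
    refine ⟨((y, b _ w) : _ × NCTensor Γ S.X₁ M), Prod.ext hy ?_⟩
    refine (hb _ _ S.f.hom.hom w).symm.trans ?_
    rw [funext hw, hab]
  · rintro ⟨q, rfl⟩
    exact LinearMap.congr_fun (congrArg (fun k => k.hom.hom) (S.map (inducedFG Γ M)).zero) q
  · obtain ⟨y, hy⟩ := h₃ p.1
    choose w hw using fun i => h₃ (a _ p.2 i)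
    refine ⟨((y, b _ w) : _ × NCTensor Γ S.X₂ M), Prod.ext hy ?_⟩
    refine (hb _ _ S.g.hom.hom w).symm.trans ?_
    rw [funext hw, hab]

variable [IsNoetherianRing Γᵐᵒᵖ] [IsNoetherianRing (TrivSqZeroExt Γ M)ᵐᵒᵖ]

instance : PreservesFiniteLimits (inducedFG Γ M) :=
  (preserves_of_shortExact _ shortExact_inducedFG).1

instance : PreservesFiniteColimits (inducedFG Γ M) :=
  (preserves_of_shortExact _ shortExact_inducedFG).2

end Exact

/-! ### Induction preserves projectives. -/

section Projective

variable [IsNoetherianRing Γᵐᵒᵖ] [IsNoetherianRing (TrivSqZeroExt Γ M)ᵐᵒᵖ]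

/-- The underlying map of right `Γ`-modules of a map out of an induced module. -/
noncomputable def Induced.restrict {X Y : Type u} [AddCommGroup Y] [Module Γᵐᵒᵖ Y] [AddCommGroup X]
    [Module (TrivSqZeroExt Γ M)ᵐᵒᵖ X] (f : Induced Γ M Y →ₗ[(TrivSqZeroExt Γ M)ᵐᵒᵖ] X) :
    Y →ₗ[Γᵐᵒᵖ] Restrict (inlOp Γ M) X where
  toFun y := f (Induced.of Γ M y)
  map_add' y y' := (congrArg f (Induced.of_add y y')).trans (map_add f _ _)
  map_smul' c y := (congrArg f (Induced.of_smul c y)).trans (map_smul f (inlOp Γ M c) _)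

/-- The adjunction argument: a lifting problem out of the induced module is restricted to `P`,
solved there because restriction preserves epimorphisms, and the solution is extended back. -/
instance [Module.Finite Γᵐᵒᵖ (Restrict (inlOp Γ M) (TrivSqZeroExt Γ M)ᵐᵒᵖ)] :
    (inducedFG Γ M).PreservesProjectiveObjects where
  projective_obj {P} _ :=
    { factors := fun {E X} f e _ => by
        let f' : P ⟶ (restrictFG (inlOp Γ M)).obj X :=
          FGModuleCat.ofHom (Induced.restrict f.hom.hom)
        let g := Projective.factorThru f' ((restrictFG (inlOp Γ M)).map e)
        have hg : g ≫ (restrictFG (inlOp Γ M)).map e = f' := Projective.factorThru_comp _ _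
        refine ⟨FGModuleCat.ofHom (Induced.extend g.hom.hom),
          FGModuleCat.hom_ext (Induced.hom_ext fun y => ?_)⟩
        have h : e.hom.hom (g.hom.hom y) = f.hom.hom (Induced.of Γ M y) :=
          congrArg (fun k => k.hom.hom y) hg
        refine Eq.trans ?_ h
        exact congrArg e.hom.hom (Induced.extend_of (X := E)
          (show P →ₗ[Γᵐᵒᵖ] Restrict (inlOp Γ M) E from g.hom.hom) y) }

end Projective

end Induction

/-! ### The kernel of the counit and tensor nilpotence -/

section Counit

open MulOpposite

attribute [local instance] Abelian.hasFiniteBiproducts NCTensor.rightModule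

variable {Γ : Type u} [Ring Γ]

/-- A right module `Z` is generated by `N` if the images of the maps `N → Z` generate `Z` as an
abelian group. -/
def IsGeneratedBy (N Z : Type u) [AddCommGroup N] [Module Γᵐᵒᵖ N] [AddCommGroup Z]
    [Module Γᵐᵒᵖ Z] : Prop :=
  ∀ S : AddSubgroup Z, (∀ (θ : N →ₗ[Γᵐᵒᵖ] Z) (w : N), θ w ∈ S) → S = ⊤

variable {N Z Z' : Type u} [AddCommGroup N] [Module Γᵐᵒᵖ N] [AddCommGroup Z] [Module Γᵐᵒᵖ Z]
  [AddCommGroup Z'] [Module Γᵐᵒᵖ Z']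

theorem IsGeneratedBy.of_surjective (h : IsGeneratedBy (Γ := Γ) N Z) (κ : Z →ₗ[Γᵐᵒᵖ] Z')
    (hκ : Function.Surjective κ) : IsGeneratedBy (Γ := Γ) N Z' := fun S hS => by
  have := h (S.comap κ.toAddMonoidHom) fun θ w => hS (κ.comp θ) w
  refine top_unique fun z' _ => ?_
  obtain ⟨z, rfl⟩ := hκ z'
  have hz : z ∈ S.comap κ.toAddMonoidHom := this ▸ AddSubgroup.mem_top z
  exact hz

theorem IsGeneratedBy.subsingleton [Subsingleton N] (h : IsGeneratedBy (Γ := Γ) N Z) :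
    Subsingleton Z := by
  have := h ⊥ fun θ w => by rw [Subsingleton.elim w 0, map_zero]; exact AddSubgroup.zero_mem _
  exact ⟨fun x y => ((AddSubgroup.mem_bot).1 (this ▸ AddSubgroup.mem_top x)).trans
    ((AddSubgroup.mem_bot).1 (this ▸ AddSubgroup.mem_top y)).symm⟩

variable {M : Type u} [AddCommGroup M] [Module Γ M] [Module Γᵐᵒᵖ M] [SMulCommClass Γ Γᵐᵒᵖ M]

/-- Each `z ⊗ m` is a sum of elements `θ(w) ⊗ m`, the images of `w ⊗ m` under the maps `θ ⊗ M`.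
Working with generation instead of iterated tensor products avoids associativity isomorphisms. -/
theorem IsGeneratedBy.tensor (h : IsGeneratedBy (Γ := Γ) N Z) :
    IsGeneratedBy (Γ := Γ) (NCTensor Γ N M) (NCTensor Γ Z M) := fun S hS =>
  NCTensor.addSubgroup_eq_top S fun z m => by
    let τ : Z →+ NCTensor Γ Z M :=
      { toFun := fun z => NCTensor.tmul z m
        map_zero' := NCTensor.zero_tmul m
        map_add' := fun z z' => NCTensor.add_tmul z z' m }
    have := h (S.comap τ) fun θ w => hS (NCTensor.mapLeft M θ) (NCTensor.tmul w m)
    have hz : z ∈ S.comap τ := this ▸ AddSubgroup.mem_top z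
    exact hz

theorem isGeneratedBy_tensor : IsGeneratedBy (Γ := Γ) M (NCTensor Γ Z M) := fun S hS =>
  NCTensor.addSubgroup_eq_top S fun z m =>
    hS { toFun := fun m => NCTensor.tmul z m
         map_add' := NCTensor.tmul_add z
         map_smul' := fun _ _ => rfl } m

/-- The multiplication map from the module induced from the restriction of `X` to `X`. -/
noncomputable def counit (Γ M : Type u) [Ring Γ] [AddCommGroup M] [Module Γ M] [Module Γᵐᵒᵖ M]
    [SMulCommClass Γ Γᵐᵒᵖ M] (X : Type u) [AddCommGroup X] [Module (TrivSqZeroExt Γ M)ᵐᵒᵖ X] :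
    Induced Γ M (Restrict (inlOp Γ M) X) →ₗ[(TrivSqZeroExt Γ M)ᵐᵒᵖ] X :=
  Induced.extend LinearMap.id

section

variable {X : Type u} [AddCommGroup X] [Module (TrivSqZeroExt Γ M)ᵐᵒᵖ X]

theorem counit_apply (p : Induced Γ M (Restrict (inlOp Γ M) X)) :
    counit Γ M X p = (show X from p.1) + mulM X p.2 := by
  have : NCTensor.map (LinearMap.id (R := Γᵐᵒᵖ) (M := Restrict (inlOp Γ M) X))
      (LinearMap.id (R := Γ) (M := M)) = AddMonoidHom.id _ := NCTensor.hom_ext fun _ _ => rfl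
  exact congrArg (fun k => (show X from p.1) + mulM X k) (DFunLike.congr_fun this p.2)

theorem counit_surjective : Function.Surjective (counit Γ M X) := fun x =>
  ⟨Induced.of Γ M x, Induced.extend_of LinearMap.id x⟩

/-- The parametrization of the kernel of the counit by the tensor product. -/
noncomputable def toKerCounit (X : Type u) [AddCommGroup X] [Module (TrivSqZeroExt Γ M)ᵐᵒᵖ X] :
    NCTensor Γ (Restrict (inlOp Γ M) X) M →ₗ[Γᵐᵒᵖ]
      Restrict (inlOp Γ M) (LinearMap.ker (counit Γ M X)) where
  toFun z := (⟨((-mulM X z, z) : X × NCTensor Γ (Restrict (inlOp Γ M) X) M), 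
    (counit_apply _).trans (neg_add_cancel _)⟩ : LinearMap.ker (counit Γ M X))
  map_add' z z' := Subtype.ext (Induced.ext
    ((congrArg Neg.neg (map_add (mulM X) z z')).trans (neg_add _ _)) rfl)
  map_smul' c z := by
    refine Subtype.ext (Induced.ext ?_ ?_)
    · refine (congrArg Neg.neg (smul_mulM (inlOp Γ M c) z).symm).trans ?_
      exact (smul_neg (inlOp Γ M c) (mulM X z)).symm
    · change c • z = c • z + NCTensor.tmul _ (0 : M)
      rw [NCTensor.tmul_zero, add_zero]

/-- An element `(x, z)` of the kernel satisfies `x = -zM`, where `zM` is the image of `z` under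
multiplication, so it is determined by `z`. -/
theorem toKerCounit_surjective : Function.Surjective (toKerCounit (Γ := Γ) (M := M) X) := by
  intro p
  obtain ⟨p, hp⟩ : LinearMap.ker (counit Γ M X) := p
  refine ⟨p.2, Subtype.ext (Induced.ext ?_ rfl)⟩
  rw [LinearMap.mem_ker, counit_apply] at hp
  exact (eq_neg_of_add_eq_zero_left hp).symm

end

/-- The linear equivalence between `Γ × M` and the trivial extension, as right `Γ`-modules. -/
def prodEquivRestrict (Γ M : Type u) [Ring Γ] [AddCommGroup M] [Module Γ M] [Module Γᵐᵒᵖ M]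
    [SMulCommClass Γ Γᵐᵒᵖ M] :
    (Γᵐᵒᵖ × M) ≃ₗ[Γᵐᵒᵖ] Restrict (inlOp Γ M) (TrivSqZeroExt Γ M)ᵐᵒᵖ where
  toFun p := (op ((p.1.unop, p.2) : Γ × M) : (TrivSqZeroExt Γ M)ᵐᵒᵖ)
  invFun a := (op (show (TrivSqZeroExt Γ M)ᵐᵒᵖ from a).unop.fst,
    (show (TrivSqZeroExt Γ M)ᵐᵒᵖ from a).unop.snd)
  map_add' _ _ := rfl
  map_smul' c p := by
    refine unop_injective (TrivSqZeroExt.ext rfl ?_)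
    change c • p.2 = p.1.unop • (0 : M) + c • p.2
    rw [smul_zero, zero_add]
  left_inv _ := rfl
  right_inv _ := rfl

instance [Module.Finite Γᵐᵒᵖ M] :
    Module.Finite Γᵐᵒᵖ (Restrict (inlOp Γ M) (TrivSqZeroExt Γ M)ᵐᵒᵖ) :=
  Module.Finite.equiv (prodEquivRestrict Γ M)

theorem projective_restrict_inlOp (h : Module.Projective Γᵐᵒᵖ M) :
    Module.Projective Γᵐᵒᵖ (Restrict (inlOp Γ M) (TrivSqZeroExt Γ M)ᵐᵒᵖ) :=
  Module.Projective.of_equiv (prodEquivRestrict Γ M)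

instance : Module.Finite (TrivSqZeroExt Γ M)ᵐᵒᵖ (Restrict (fstOp Γ M) Γᵐᵒᵖ) :=
  finite_restrict_of_surjective fun c => ⟨inlOp Γ M c, rfl⟩

variable [Module.Finite Γᵐᵒᵖ M] [IsNoetherianRing (TrivSqZeroExt Γ M)ᵐᵒᵖ]

/-- The kernel of the counit, as a finitely generated module. -/
noncomputable def kerCounit (Γ M : Type u) [Ring Γ] [AddCommGroup M] [Module Γ M] [Module Γᵐᵒᵖ M]
    [SMulCommClass Γ Γᵐᵒᵖ M] [Module.Finite Γᵐᵒᵖ M] [IsNoetherianRing (TrivSqZeroExt Γ M)ᵐᵒᵖ]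
    (X : FGModuleCat.{u} (TrivSqZeroExt Γ M)ᵐᵒᵖ) : FGModuleCat.{u} (TrivSqZeroExt Γ M)ᵐᵒᵖ :=
  FGModuleCat.of _ (LinearMap.ker (counit Γ M X))

theorem isExtension_kerCounit (X : FGModuleCat.{u} (TrivSqZeroExt Γ M)ᵐᵒᵖ) :
    IsExtension (kerCounit Γ M X) ((inducedFG Γ M).obj ((restrictFG (inlOp Γ M)).obj X)) X := by
  refine ⟨FGModuleCat.ofHom (LinearMap.ker (counit Γ M X)).subtype,
    FGModuleCat.ofHom (counit Γ M X), ?_, ?_⟩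
  · exact FGModuleCat.hom_ext (LinearMap.ext fun x => x.2)
  · rw [shortExact_fgModuleCat_iff]
    exact ⟨Subtype.val_injective, LinearMap.exact_subtype_ker_map _, counit_surjective⟩

/-- Over `Γ`, each application of `kerCounit` is a quotient of a tensor product with `M`, so it
multiplies the generating bimodule by one more factor `M`. The first application needs no
information about `X`. -/
theorem isGeneratedBy_iterate_kerCounit (X : FGModuleCat.{u} (TrivSqZeroExt Γ M)ᵐᵒᵖ) (j : ℕ) :
    IsGeneratedBy (Γ := Γ) (tensorPower Γ M (j + 1)).carrier
      (Restrict (inlOp Γ M) ((kerCounit Γ M)^[j + 1] X)) := by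
  induction j with
  | zero =>
    have h : IsGeneratedBy (Γ := Γ) M (NCTensor Γ (Restrict (inlOp Γ M) X) M) :=
      isGeneratedBy_tensor
    exact h.of_surjective _ toKerCounit_surjective
  | succ j ih =>
    rw [Function.iterate_succ_apply']
    exact ih.tensor.of_surjective _ toKerCounit_surjective

theorem isZero_iterate_kerCounit {n : ℕ} (hn : 1 ≤ n)
    (h : Subsingleton (tensorPower Γ M n).carrier) (X : FGModuleCat.{u} (TrivSqZeroExt Γ M)ᵐᵒᵖ) :
    IsZero ((kerCounit Γ M)^[n] X) := by
  obtain ⟨j, rfl⟩ := Nat.exists_eq_add_of_le' hn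
  have : Subsingleton ((kerCounit Γ M)^[j + 1] X) :=
    (isGeneratedBy_iterate_kerCounit X j).subsingleton
  rw [IsZero.iff_id_eq_zero]
  exact FGModuleCat.hom_ext (LinearMap.ext fun x =>
    Subsingleton.elim (α := (kerCounit Γ M)^[j + 1] X) _ _)

end Counit

/-! ### Dimensions of trivial extensions -/

section Bounds

variable {Γ M : Type u} [Ring Γ] [AddCommGroup M] [Module Γ M] [Module Γᵐᵒᵖ M]
  [SMulCommClass Γ Γᵐᵒᵖ M]

theorem inlOp_fstOp_of_subsingleton [Subsingleton M] (a : (TrivSqZeroExt Γ M)ᵐᵒᵖ) :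
    inlOp Γ M (fstOp Γ M a) = a :=
  MulOpposite.unop_injective (TrivSqZeroExt.ext rfl (Subsingleton.elim _ _))

/-- For `n = 1` the first tensor power is `M` itself, so `M = 0`; for `n ≥ 2` the bound with factor
`2` is already strong enough. -/
theorem bound_of_two_or_subsingleton {n : ℕ} (hn : 1 ≤ n)
    (hM : Subsingleton (tensorPower Γ M n).carrier) {x y : ℕ∞} (h₁ : Subsingleton M → x ≤ y)
    (h₂ : x ≤ (2 : ℕ) * (y + 1) - 1) : x ≤ n * (y + 1) - 1 := by
  obtain rfl | hn := hn.eq_or_lt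
  · have hx := h₁ hM
    rwa [Nat.cast_one, one_mul, AddLECancellable.add_tsub_cancel_right]
    exact ENat.addLECancellable_of_ne_top ENat.one_ne_top
  · exact h₂.trans (by gcongr; exact hn)

variable [Module.Finite Γᵐᵒᵖ M] [IsNoetherianRing Γᵐᵒᵖ] [IsNoetherianRing (TrivSqZeroExt Γ M)ᵐᵒᵖ]

theorem igusaTodorovDistance_trivSqZeroExt_bounds [Module.Finite Γ M] (h : Module.Projective Γ M)
    (h' : Module.Projective Γᵐᵒᵖ M) {n : ℕ} (hn : 1 ≤ n)
    (hM : Subsingleton (tensorPower Γ M n).carrier) :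
    IT Γ ≤ IT (TrivSqZeroExt Γ M) ∧ IT (TrivSqZeroExt Γ M) ≤ n * (IT Γ + 1) - 1 := by
  have := preservesProjectiveObjects_restrictFG (inlOp Γ M) (projective_restrict_inlOp h')
  exact ⟨igusaTodorovDistance_le_of_section (restrictFG (inlOp Γ M)) (restrictFG (fstOp Γ M))
      (restrictFGCompIso _ _ fstOp_inlOp),
    igusaTodorovDistance_le_of_nilpotent (isProjectiveGenerator_self _)
      (isProjectiveGenerator_self _) (inducedFG Γ M) (restrictFG (inlOp Γ M)).obj (kerCounit Γ M)
      isExtension_kerCounit hn (isZero_iterate_kerCounit hn hM)⟩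

theorem extensionDimension_trivSqZeroExt_bounds {n : ℕ} (hn : 1 ≤ n)
    (hM : Subsingleton (tensorPower Γ M n).carrier) :
    extDim Γ ≤ extDim (TrivSqZeroExt Γ M) ∧
      extDim (TrivSqZeroExt Γ M) ≤ n * (extDim Γ + 1) - 1 :=
  ⟨extensionDimension_le_of_section (restrictFG (inlOp Γ M)) (restrictFG (fstOp Γ M))
      (restrictFGCompIso _ _ fstOp_inlOp),
    bound_of_two_or_subsingleton hn hM
      (fun _ => extensionDimension_le_of_section (restrictFG (fstOp Γ M)) (restrictFG (inlOp Γ M))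
        (restrictFGCompIso _ _ inlOp_fstOp_of_subsingleton))
      (extensionDimension_le_of_extension (restrictFG (fstOp Γ M)) _ _ fun X =>
        (killed_shortExact (inlOp Γ M) (fstOp Γ M) fstOp_inlOp
          mul_eq_zero_of_fstOp X).isExtension)⟩

theorem derivedDimension_trivSqZeroExt_bounds {n : ℕ} (hn : 1 ≤ n)
    (hM : Subsingleton (tensorPower Γ M n).carrier) :
    derDim Γ ≤ derDim (TrivSqZeroExt Γ M) ∧
      derDim (TrivSqZeroExt Γ M) ≤ n * (derDim Γ + 1) - 1 :=
  ⟨derivedDimension_le_of_section (restrictFG (inlOp Γ M)) (restrictFG (fstOp Γ M))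
      (restrictFGCompIso _ _ fstOp_inlOp),
    bound_of_two_or_subsingleton hn hM
      (fun _ => derivedDimension_le_of_section (restrictFG (fstOp Γ M)) (restrictFG (inlOp Γ M))
        (restrictFGCompIso _ _ inlOp_fstOp_of_subsingleton))
      (derivedDimension_le_of_extension (restrictFG (fstOp Γ M))
        (killedFunctor (fstOp Γ M) ⋙ restrictFG (inlOp Γ M))
        (killedQuotientFunctor (fstOp Γ M) ⋙ restrictFG (inlOp Γ M))
        (killedInclusion _ _ fstOp_inlOp)
        (killedProjection _ _ fstOp_inlOp mul_eq_zero_of_fstOp)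
        (killed_comp_eq_zero _ _ fstOp_inlOp mul_eq_zero_of_fstOp)
        (killed_shortExact _ _ fstOp_inlOp mul_eq_zero_of_fstOp))⟩

end Bounds
end CleftDim

theorem mainTheorem8 {R : Type w} {Γ M : Type u}
    [CommRing R] [IsNoetherianRing R] [Ring Γ] [Algebra R Γ] [Module.Finite R Γ]
    [AddCommGroup M] [Module Γ M] [Module Γᵐᵒᵖ M] [SMulCommClass Γ Γᵐᵒᵖ M]
    [Module R M] [IsScalarTower R Γ M] [IsScalarTower R Γᵐᵒᵖ M] [Module.Finite R M]
    (n : ℕ) (hn : 1 ≤ n) (hM : Subsingleton (CleftDim.tensorPower Γ M n).carrier) :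
    haveI : IsNoetherianRing Γᵐᵒᵖ := CleftDim.isNoetherianRing_op R Γ
    haveI : Module.Finite R (TrivSqZeroExt Γ M) := CleftDim.finite_trivSqZeroExt R Γ M
    haveI : IsNoetherianRing (TrivSqZeroExt Γ M)ᵐᵒᵖ :=
      CleftDim.isNoetherianRing_op R (TrivSqZeroExt Γ M)
    ((Module.Projective Γ M ∧ Module.Projective Γᵐᵒᵖ M) →
      CleftDim.IT Γ ≤ CleftDim.IT (TrivSqZeroExt Γ M) ∧
      CleftDim.IT (TrivSqZeroExt Γ M) ≤ n * (CleftDim.IT Γ + 1) - 1) ∧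
    (Module.Projective Γᵐᵒᵖ M →
      CleftDim.extDim Γ ≤ CleftDim.extDim (TrivSqZeroExt Γ M) ∧
      CleftDim.extDim (TrivSqZeroExt Γ M) ≤ n * (CleftDim.extDim Γ + 1) - 1) ∧
    (CleftDim.IsLeftPerfect Γ M →
      CleftDim.derDim Γ ≤ CleftDim.derDim (TrivSqZeroExt Γ M) ∧
      CleftDim.derDim (TrivSqZeroExt Γ M) ≤ n * (CleftDim.derDim Γ + 1) - 1) := by
  have : Module.Finite Γ M := Module.Finite.of_restrictScalars_finite R Γ M
  have : Module.Finite Γᵐᵒᵖ M := Module.Finite.of_restrictScalars_finite R Γᵐᵒᵖ M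
  have : IsNoetherianRing Γᵐᵒᵖ := CleftDim.isNoetherianRing_op R Γ
  have : Module.Finite R (TrivSqZeroExt Γ M) := CleftDim.finite_trivSqZeroExt R Γ M
  have : IsNoetherianRing (TrivSqZeroExt Γ M)ᵐᵒᵖ :=
    CleftDim.isNoetherianRing_op R (TrivSqZeroExt Γ M)
  exact ⟨fun h => CleftDim.igusaTodorovDistance_trivSqZeroExt_bounds h.1 h.2 hn hM,
    fun _ => CleftDim.extensionDimension_trivSqZeroExt_bounds hn hM,
    fun _ => CleftDim.derivedDimension_trivSqZeroExt_bounds hn hM⟩
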